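/- **Machine model.** Programs run on a real RAM: a random access memory of words (natural numbers) and a random access memory of real numbers, both initially zero, and a read-only input consisting of words and real numbers. A program is built from assignments of expressions to memory cells (at computed addresses) by sequential composition, conditionals and while loops. Expressions are finite, loop-free and free of side effects; they are built from constants (natural numbers and rationals), reads of memory and input at computed addresses, the word operations (addition, truncated subtraction, multiplication, division, remainder, bitwise operations, shifts), exact real arithmetic $+,-,\times,/$, conversion of words to reals, comparisons, and conditional expressions. Each assignment and each evaluation of a test counts as one step (its cost is a constant depending only on the program). A program solves a problem in $O(T)$ time if there are constants $C,c$ such that on every admissible input it halts with the correct output after at most $C\cdot T$ steps, and no word occurring in the run exceeds $(s+2)^c$, where $s$ is the size parameter of the input (so words have $O(\log s)$ bits): $s=n_0$ for a graph with $n_0\ge 1$ vertices, given by $n_0$ and its adjacency matrix, and $s=n+m$ for $n\ge 1$ points and $m\ge 1$ points or hypercubes, given by $n$, $m$ and real coordinates. **Combinatorial programs.** Fix an arbitrary set $\mathcal C$ of programs. The *combinatorial* programs (over $\mathcal C$) form the least set of programs that contains $\mathcal C$ and is closed under *local reductions*: if $A$ is combinatorial, then so is the program obtained from $A$ by replacing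 every access to the $i$-th input word by $f(i)$ and every access to the $i$-th input real by $g(i)$, where $f,g$ are expressions in the variable $i$ that may read the actual input but not the memory, followed by one assignment of an expression to the first word of the memory (the output cell). (If $\mathcal C$ is already closed under local reductions, the combinatorial programs are exactly those in $\mathcal C$.) **Combinatorial $k$-Clique Hypothesis.** For every constant $k\ge 3$ and every constant $\delta>0$, there is no $O(n_0^{k-\delta})$-time combinatorial program that detects whether a graph with $n_0$ vertices contains a $k$-clique. **Problem 0 ($L_\infty$ translational Hausdorff).** Given a set $P$ of $n$ points and a set $Q$ of $m$ points in $\mathbb R^d$, compute $\min_{v\in\mathbb R^d}\vec h_\infty(P+v,Q)$, where $\vec h_\infty(P,Q)=\max_{p\in P}\min_{q\in Q}\|p-q\|_\infty$. **Problem 1 (decision version).** Given a set $P$ of $n$ points and a set $\mathcal Q$ of $m$ axis-aligned closed unit hypercubes (given by their centres) in $\mathbb R^d$, decide whether $\bigcap_{p\in P}(S^*-p)=\emptyset$, where $S^*=\bigcup_{B\in\mathcal Q}B$. **Theorem.** Let $d\ge 1$ be a constant and assume the Combinatorial $k$-Clique Hypothesis. Then: 1. For every constant $\delta>0$, neither Problem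 0 nor Problem 1, restricted to inputs with $m=n$, has an $O(n^{d-\delta})$-time combinatorial program. 2. More generally, for every fixed rational $\gamma$ with $0<\gamma\le 1$ and every constant $\delta>0$, neither Problem 0 nor Problem 1, restricted to inputs with $m=n^{\gamma}$, has an $O((mn)^{d/2-\delta})$-time combinatorial program. 3. For every fixed real $\gamma$ with $0\le\gamma\le 1$ and all constants $\varepsilon,\delta>0$, neither Problem 0 nor Problem 1, restricted to inputs with $n^{\gamma-\varepsilon}\le m\le n^{\gamma+\varepsilon}$, has an $O((mn)^{d/2-\delta})$-time combinatorial program. -/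

import Mathlib

/-! ### Real RAM programs

The machine has a random access memory of words (natural numbers), a random access memory of real
numbers, and a read-only input consisting of words and real numbers. -/

/-- The types of expressions. -/
inductive Ty where
  | word
  | real
  | bool

/-- The values of an expression of a given type. -/
abbrev Ty.Val : Ty → Type
  | .word => ℕ
  | .real => ℝ
  | .bool => Bool

/-- The usual operations of a word RAM; `sub` is truncated at `0`. -/
inductive WordOp where
  | add | sub | mul | div | mod | land | lor | xor | shiftLeft | shiftRight

def WordOp.eval : WordOp → ℕ → ℕ → ℕ
  | .add, a, b => a + b
  | .sub, a, b => a - b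
  | .mul, a, b => a * b
  | .div, a, b => a / b
  | .mod, a, b => a % b
  | .land, a, b => a &&& b
  | .lor, a, b => a ||| b
  | .xor, a, b => a ^^^ b
  | .shiftLeft, a, b => a <<< b
  | .shiftRight, a, b => a >>> b

/-- The exact arithmetic operations on real numbers; there is no rounding operation. -/
inductive RealOp where
  | add | sub | mul | div

noncomputable def RealOp.eval : RealOp → ℝ → ℝ → ℝ
  | .add, x, y => x + y
  | .sub, x, y => x - y
  | .mul, x, y => x * y
  | .div, x, y => x / y

/-- Side-effect free expressions. An expression has a fixed size and no loops, so it is evaluated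
by a constant number of elementary machine operations.
`wmem`, `rmem` read the memory and `winp`, `rinp` read the input at a computed address.
`idx` is a variable, used in the code of local reductions (see `redirect`);
in a running program it just has the value `0`. -/
inductive Expr : Ty → Type where
  | idx : Expr .word
  | wconst : ℕ → Expr .word
  | rconst : ℚ → Expr .real
  | wmem : Expr .word → Expr .word
  | rmem : Expr .word → Expr .real
  | winp : Expr .word → Expr .word
  | rinp : Expr .word → Expr .real
  | wop : WordOp → Expr .word → Expr .word → Expr .word
  | rop : RealOp → Expr .real → Expr .real → Expr .real
  | cast : Expr .word → Expr .real
  | wle : Expr .word → Expr .word → Expr .bool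
  | rle : Expr .real → Expr .real → Expr .bool
  | not : Expr .bool → Expr .bool
  | and : Expr .bool → Expr .bool → Expr .bool
  | wite : Expr .bool → Expr .word → Expr .word → Expr .word
  | rite : Expr .bool → Expr .real → Expr .real → Expr .real

/-- The read-only input of a program. -/
structure Input where
  words : ℕ → ℕ
  reals : ℕ → ℝ

/-- The contents of the memory. -/
structure Memory where
  words : ℕ → ℕ
  reals : ℕ → ℝ

/-- The initial memory contains only zeros. -/
def Memory.zero : Memory := ⟨fun _ => 0, fun _ => 0⟩

open Classical in
/-- The value of an expression on a given input and memory, with `i` as the value of `idx`. -/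
noncomputable def Expr.eval (inp : Input) (s : Memory) (i : ℕ) : {τ : Ty} → Expr τ → τ.Val
  | _, .idx => i
  | _, .wconst c => c
  | _, .rconst q => (q : ℝ)
  | _, .wmem a => s.words (a.eval inp s i)
  | _, .rmem a => s.reals (a.eval inp s i)
  | _, .winp a => inp.words (a.eval inp s i)
  | _, .rinp a => inp.reals (a.eval inp s i)
  | _, .wop o a b => o.eval (a.eval inp s i) (b.eval inp s i)
  | _, .rop o a b => o.eval (a.eval inp s i) (b.eval inp s i)
  | _, .cast a => ((a.eval inp s i : ℕ) : ℝ)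
  | _, .wle a b => decide ((a.eval inp s i : ℕ) ≤ (b.eval inp s i : ℕ))
  | _, .rle a b => decide ((a.eval inp s i : ℝ) ≤ (b.eval inp s i : ℝ))
  | _, .not a => Bool.not (a.eval inp s i)
  | _, .and a b => Bool.and (a.eval inp s i) (b.eval inp s i)
  | _, .wite c a b => bif c.eval inp s i then a.eval inp s i else b.eval inp s i
  | _, .rite c a b => bif c.eval inp s i then a.eval inp s i else b.eval inp s i

/-- The truth of a test. -/
def Expr.Holds (inp : Input) (s : Memory) (i : ℕ) (c : Expr .bool) : Prop :=
  c.eval inp s i = true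

/-- All words that occur in the evaluation of the expression (including intermediate results and
addresses) are at most `B`. In a conditional only the branch that is taken is evaluated. -/
def Expr.Fits (inp : Input) (s : Memory) (i B : ℕ) : {τ : Ty} → Expr τ → Prop
  | _, .idx => i ≤ B
  | _, .wconst c => c ≤ B
  | _, .rconst _ => True
  | _, .wmem a => a.Fits inp s i B ∧ s.words (a.eval inp s i) ≤ B
  | _, .rmem a => a.Fits inp s i B
  | _, .winp a => a.Fits inp s i B ∧ inp.words (a.eval inp s i) ≤ B
  | _, .rinp a => a.Fits inp s i B
  | _, .wop o a b =>
      a.Fits inp s i B ∧ b.Fits inp s i B ∧ o.eval (a.eval inp s i) (b.eval inp s i) ≤ B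
  | _, .rop _ a b => a.Fits inp s i B ∧ b.Fits inp s i B
  | _, .cast a => a.Fits inp s i B
  | _, .wle a b => a.Fits inp s i B ∧ b.Fits inp s i B
  | _, .rle a b => a.Fits inp s i B ∧ b.Fits inp s i B
  | _, .not a => a.Fits inp s i B
  | _, .and a b => a.Fits inp s i B ∧ b.Fits inp s i B
  | _, .wite c a b => c.Fits inp s i B ∧
      (c.Holds inp s i → a.Fits inp s i B) ∧
      (¬ c.Holds inp s i → b.Fits inp s i B)
  | _, .rite c a b => c.Fits inp s i B ∧
      (c.Holds inp s i → a.Fits inp s i B) ∧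
      (¬ c.Holds inp s i → b.Fits inp s i B)

/-- Programs: assignments to a memory cell at a computed address, sequential composition,
conditionals and while loops. -/
inductive Program where
  | wset : Expr .word → Expr .word → Program
  | rset : Expr .word → Expr .real → Program
  | seq : Program → Program → Program
  | ite : Expr .bool → Program → Program → Program
  | loop : Expr .bool → Program → Program

/-- `Exec inp B p s t s'`: on input `inp`, started with memory `s`, the program `p` halts after `t`
steps with memory `s'`, and no word greater than `B` ever occurs (a run in which a larger word
would occur is stuck). Every assignment and every evaluation of a test is one step. -/
inductive Exec (inp : Input) (B : ℕ) : Program → Memory → ℕ → Memory → Prop where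
  | wset {a e : Expr .word} {s : Memory} :
      a.Fits inp s 0 B → e.Fits inp s 0 B →
      Exec inp B (.wset a e) s 1
        ⟨Function.update s.words (a.eval inp s 0) (e.eval inp s 0), s.reals⟩
  | rset {a : Expr .word} {e : Expr .real} {s : Memory} :
      a.Fits inp s 0 B → e.Fits inp s 0 B →
      Exec inp B (.rset a e) s 1
        ⟨s.words, Function.update s.reals (a.eval inp s 0) (e.eval inp s 0)⟩
  | seq {p q : Program} {s s' s'' : Memory} {t t' : ℕ} :
      Exec inp B p s t s' → Exec inp B q s' t' s'' → Exec inp B (.seq p q) s (t + t') s''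
  | ite_true {c : Expr .bool} {p q : Program} {s s' : Memory} {t : ℕ} :
      c.Fits inp s 0 B → c.Holds inp s 0 → Exec inp B p s t s' →
      Exec inp B (.ite c p q) s (t + 1) s'
  | ite_false {c : Expr .bool} {p q : Program} {s s' : Memory} {t : ℕ} :
      c.Fits inp s 0 B → ¬ c.Holds inp s 0 → Exec inp B q s t s' →
      Exec inp B (.ite c p q) s (t + 1) s'
  | loop_done {c : Expr .bool} {p : Program} {s : Memory} :
      c.Fits inp s 0 B → ¬ c.Holds inp s 0 → Exec inp B (.loop c p) s 1 s
  | loop_step {c : Expr .bool} {p : Program} {s s' s'' : Memory} {t t' : ℕ} :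
      c.Fits inp s 0 B → c.Holds inp s 0 → Exec inp B p s t s' →
      Exec inp B (.loop c p) s' t' s'' → Exec inp B (.loop c p) s (t + t' + 1) s''

/-! ### Combinatorial programs

There is no agreed formal definition of a combinatorial algorithm. So an arbitrary set `𝒞` of
programs is taken as the starting point, and the only further programs counted as combinatorial are
those that run a combinatorial program on a *locally* transformed input, each word and each number
of which is computed from the actual input, whenever it is read, by a memoryless loop-free
expression, and then compute their output by one expression. -/

/-- The expression does not access the memory. -/
def Expr.MemFree : {τ : Ty} → Expr τ → Prop
  | _, .idx => True
  | _, .wconst _ => True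
  | _, .rconst _ => True
  | _, .wmem _ => False
  | _, .rmem _ => False
  | _, .winp a => a.MemFree
  | _, .rinp a => a.MemFree
  | _, .wop _ a b => a.MemFree ∧ b.MemFree
  | _, .rop _ a b => a.MemFree ∧ b.MemFree
  | _, .cast a => a.MemFree
  | _, .wle a b => a.MemFree ∧ b.MemFree
  | _, .rle a b => a.MemFree ∧ b.MemFree
  | _, .not a => a.MemFree
  | _, .and a b => a.MemFree ∧ b.MemFree
  | _, .wite c a b => c.MemFree ∧ a.MemFree ∧ b.MemFree
  | _, .rite c a b => c.MemFree ∧ a.MemFree ∧ b.MemFree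

/-- `instIdx e f` is `f` with `e` substituted for the variable `idx`. -/
def instIdx (e : Expr .word) : {τ : Ty} → Expr τ → Expr τ
  | _, .idx => e
  | _, .wconst c => .wconst c
  | _, .rconst q => .rconst q
  | _, .wmem a => .wmem (instIdx e a)
  | _, .rmem a => .rmem (instIdx e a)
  | _, .winp a => .winp (instIdx e a)
  | _, .rinp a => .rinp (instIdx e a)
  | _, .wop o a b => .wop o (instIdx e a) (instIdx e b)
  | _, .rop o a b => .rop o (instIdx e a) (instIdx e b)
  | _, .cast a => .cast (instIdx e a)
  | _, .wle a b => .wle (instIdx e a) (instIdx e b)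
  | _, .rle a b => .rle (instIdx e a) (instIdx e b)
  | _, .not a => .not (instIdx e a)
  | _, .and a b => .and (instIdx e a) (instIdx e b)
  | _, .wite c a b => .wite (instIdx e c) (instIdx e a) (instIdx e b)
  | _, .rite c a b => .rite (instIdx e c) (instIdx e a) (instIdx e b)

/-- Every access to word (real) number `i` of the input is replaced by the code `f` (`g`), in which
the variable `idx` stands for `i`. -/
def redirect (f : Expr .word) (g : Expr .real) : {τ : Ty} → Expr τ → Expr τ
  | _, .idx => .idx
  | _, .wconst c => .wconst c
  | _, .rconst q => .rconst q
  | _, .wmem a => .wmem (redirect f g a)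
  | _, .rmem a => .rmem (redirect f g a)
  | _, .winp a => instIdx (redirect f g a) f
  | _, .rinp a => instIdx (redirect f g a) g
  | _, .wop o a b => .wop o (redirect f g a) (redirect f g b)
  | _, .rop o a b => .rop o (redirect f g a) (redirect f g b)
  | _, .cast a => .cast (redirect f g a)
  | _, .wle a b => .wle (redirect f g a) (redirect f g b)
  | _, .rle a b => .rle (redirect f g a) (redirect f g b)
  | _, .not a => .not (redirect f g a)
  | _, .and a b => .and (redirect f g a) (redirect f g b)
  | _, .wite c a b => .wite (redirect f g c) (redirect f g a) (redirect f g b)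
  | _, .rite c a b => .rite (redirect f g c) (redirect f g a) (redirect f g b)

/-- The program that behaves as `p` does on the input described by the codes `f` and `g`. -/
def redirectProgram (f : Expr .word) (g : Expr .real) : Program → Program
  | .wset a e => .wset (redirect f g a) (redirect f g e)
  | .rset a e => .rset (redirect f g a) (redirect f g e)
  | .seq p q => .seq (redirectProgram f g p) (redirectProgram f g q)
  | .ite c p q => .ite (redirect f g c) (redirectProgram f g p) (redirectProgram f g q)
  | .loop c p => .loop (redirect f g c) (redirectProgram f g p)

/-- The combinatorial programs over a set `𝒞` of programs: the least set of programs that contains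
`𝒞` and is closed under local reductions, that is, under running a program on a locally transformed
input and then assigning the value of one expression to the output cell. -/
inductive Combinatorial (𝒞 : Set Program) : Program → Prop where
  | base {p : Program} : p ∈ 𝒞 → Combinatorial 𝒞 p
  | local_reduction {p : Program} (f : Expr .word) (g : Expr .real) (out : Expr .word) :
      f.MemFree → g.MemFree → Combinatorial 𝒞 p →
      Combinatorial 𝒞 (.seq (redirectProgram f g p) (.wset (.wconst 0) out))

/-! ### The clique problem -/

open Classical in
/-- The encoding of a graph: the number of vertices, followed by the adjacency matrix. -/
noncomputable def cliqueInput {n : ℕ} (G : SimpleGraph (Fin n)) : Input where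
  words a :=
    if a = 0 then n
    else if ∃ i j : Fin n, a = 1 + (i * n + j) ∧ G.Adj i j then 1 else 0
  reals _ := 0

/-- The program decides in `O(T n)` time whether a graph with `n ≥ 1` vertices has a `k`-clique
(answer `1` in word `0`), using words of `O(log n)` bits. -/
def DetectsClique (k : ℕ) (T : ℕ → ℝ) (p : Program) : Prop :=
  ∃ (C : ℝ) (c : ℕ), ∀ n : ℕ, 1 ≤ n → ∀ G : SimpleGraph (Fin n),
    ∃ (t : ℕ) (s : Memory),
      Exec (cliqueInput G) ((n + 2) ^ c) p Memory.zero t s ∧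
      (t : ℝ) ≤ C * T n ∧
      (s.words 0 = 1 ↔ ∃ K : Finset (Fin n), G.IsNClique k K)

/-- The Combinatorial `k`-Clique Hypothesis. -/
def CombinatorialCliqueHypothesis (𝒞 : Set Program) : Prop :=
  ∀ k : ℕ, 3 ≤ k → ∀ δ : ℝ, 0 < δ →
    ¬ ∃ p : Program, Combinatorial 𝒞 p ∧ DetectsClique k (fun n => (n : ℝ) ^ ((k : ℝ) - δ)) p

/-! ### The translational Hausdorff distance -/

/-- The encoding of `n` points `P` and `m` points `Q` in `ℝ^d`: the words `n`, `m`, and the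
coordinates of the points, one point after the other, first those of `P` and then those of `Q`. -/
def pointsInput {d n m : ℕ} (P : Fin n → Fin d → ℝ) (Q : Fin m → Fin d → ℝ) : Input where
  words a := if a = 0 then n else if a = 1 then m else 0
  reals a :=
    if h : a / d < n ∧ 0 < d then P ⟨a / d, h.1⟩ ⟨a % d, Nat.mod_lt _ h.2⟩
    else if h : a / d - n < m ∧ 0 < d then Q ⟨a / d - n, h.1⟩ ⟨a % d, Nat.mod_lt _ h.2⟩
    else 0

/-- The directed Hausdorff distance from `P` to `Q` in the `L_∞` metric, which is the metric of
`Fin d → ℝ`. -/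
noncomputable def directedHausdorff {d n m : ℕ} (P : Fin n → Fin d → ℝ) (Q : Fin m → Fin d → ℝ) :
    ℝ :=
  ⨆ i : Fin n, ⨅ j : Fin m, ‖P i - Q j‖

/-- The unit hypercube with centre `q`. -/
def unitHypercube {d : ℕ} (q : Fin d → ℝ) : Set (Fin d → ℝ) :=
  Set.Icc (fun c => q c - 1 / 2) (fun c => q c + 1 / 2)

/-- The intersection of the sets `S - p`, for `p` in `P`, where `S` is the union of the unit
hypercubes with centres in `Q`. -/
def translationSet {d n m : ℕ} (P : Fin n → Fin d → ℝ) (Q : Fin m → Fin d → ℝ) :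
    Set (Fin d → ℝ) :=
  ⋂ i : Fin n, (fun x => x - P i) '' (⋃ j : Fin m, unitHypercube (Q j))

/-- On all sets of `n` points and of `m` points in `ℝ^d` with `n, m ≥ 1` and `R n m`, the program
computes (in real cell `0`) the minimum directed `L_∞` Hausdorff distance under translation, in
`O(T n m)` time, using words of `O(log (n + m))` bits. -/
def SolvesHausdorff (d : ℕ) (R : ℕ → ℕ → Prop) (T : ℕ → ℕ → ℝ) (p : Program) : Prop :=
  ∃ (C : ℝ) (c : ℕ), ∀ n m : ℕ, 1 ≤ n → 1 ≤ m → R n m →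
    ∀ (P : Fin n → Fin d → ℝ) (Q : Fin m → Fin d → ℝ),
      Function.Injective P → Function.Injective Q →
      ∃ (t : ℕ) (s : Memory),
        Exec (pointsInput P Q) ((n + m + 2) ^ c) p Memory.zero t s ∧
        (t : ℝ) ≤ C * T n m ∧
        IsLeast (Set.range fun v : Fin d → ℝ => directedHausdorff (fun i => P i + v) Q)
          (s.reals 0)

/-- On all sets of `n` points and of `m` unit hypercubes (given by their centres) in `ℝ^d` with
`n, m ≥ 1` and `R n m`, the program decides (with answer `1` in word `0`) whether the intersection
in the decision problem is empty, in `O(T n m)` time, using words of `O(log (n + m))` bits. -/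
def SolvesHausdorffDecision (d : ℕ) (R : ℕ → ℕ → Prop) (T : ℕ → ℕ → ℝ) (p : Program) : Prop :=
  ∃ (C : ℝ) (c : ℕ), ∀ n m : ℕ, 1 ≤ n → 1 ≤ m → R n m →
    ∀ (P : Fin n → Fin d → ℝ) (Q : Fin m → Fin d → ℝ),
      Function.Injective P → Function.Injective Q →
      ∃ (t : ℕ) (s : Memory),
        Exec (pointsInput P Q) ((n + m + 2) ^ c) p Memory.zero t s ∧
        (t : ℝ) ≤ C * T n m ∧
        (s.words 0 = 1 ↔ translationSet P Q = ∅)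

/-- Neither the optimization problem nor the decision problem, restricted to `n` points and `m`
points or unit hypercubes with `R n m`, has an `O(T n m)`-time combinatorial algorithm. -/
def NoCombinatorialAlgorithm (𝒞 : Set Program) (d : ℕ) (R : ℕ → ℕ → Prop) (T : ℕ → ℕ → ℝ) : Prop :=
  (¬ ∃ p : Program, Combinatorial 𝒞 p ∧ SolvesHausdorff d R T p) ∧
  (¬ ∃ p : Program, Combinatorial 𝒞 p ∧ SolvesHausdorffDecision d R T p)

/-! ### Executing a redirected program -/

/-! Put `k = d * ℓ`. A `k`-clique is encoded by a translation vector: after scaling, coordinate `c`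
is a number `x c` with `ℓ` digits in base `A = K * n`, and the digits are the vertices. The vector
encodes a clique iff any two digits at different positions `(a, i)`, `(b, j)` are adjacent.
Requiring every translated point to be covered by hypercubes expresses this: each point excludes
some vectors with a non-adjacent pair of digits.

There is one gadget for each `(a, b, i, j)`, in a slot of its own along coordinate `0`, so that a
point can only be covered by hypercubes of its own gadget. The hypercubes are much wider than the
range of `x`, so they act as half-spaces and quadrants. If `a = b`, two half-spaces leave one gap,
and a point with shift `s` excludes `x a = s`. If `a ≠ b`, a point with shifts `s`, `s'` sees the
offsets `u = x a - s` and `w = x b - s'`. Two opposite staircases of quadrants meet along the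
antidiagonal `w = -u`; withdrawing the lower quadrant with parameter `t` by one unit opens a hole
exactly at `(t, -t)`. So one point excludes all pairs `(s + t, s' - t)` with a hole at `t`. The
holes are at those `t` with `ℓ₁` digits below `n` whose digits at places `i` and `j` vanish. As `2 *
n ≤ A`, the additions involved have no carries, and every excluded encoding has the same digit `i`
of `x a` and the same digit `j` of `x b`.

In this way `ℓ₁` digits move from the points to the hypercubes: `A ^ (7 + 2ℓ - ℓ₁)` points and `A ^
(5 + ℓ₁)` hypercubes suffice. The product is `A ^ (2ℓ + 12)` for every `ℓ₁`, so `ℓ₁` adjusts the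
ratio of the exponents to `γ`, and for large `ℓ` the saving `δ` outweighs the constant overhead,
which gives a clique algorithm with exponent `k - 1`.

The two directions of correctness are `Layout.exists_cube_of_clique` and
`Layout.exists_clique_of_covered`; the latter rounds an arbitrary real vector to an encoding. Each
coordinate of the instance is a fixed expression in the graph and the address, so the reduction is
local (`exists_redirected_program`). The optimization problem decides the decision problem by
comparing the minimum with `1 / 2` (`isLeast_le_half_iff`). -/

theorem Expr.eval_le_of_fits {inp : Input} {s : Memory} {i B : ℕ} :
    ∀ e : Expr .word, e.Fits inp s i B → (e.eval inp s i : ℕ) ≤ B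
  | .idx, h => h
  | .wconst _, h => h
  | .wmem _, h => h.2
  | .winp _, h => h.2
  | .wop _ _ _, h => h.2.2
  | .wite c a b, h => by
    obtain ⟨-, ha, hb⟩ := h
    unfold Expr.eval
    by_cases hc : c.Holds inp s i
    · have hc' : c.eval inp s i = true := hc
      rw [hc']
      exact eval_le_of_fits a (ha hc)
    · have hc' : c.eval inp s i = false := by simpa [Expr.Holds] using hc
      rw [hc']
      exact eval_le_of_fits b (hb hc)

theorem Expr.Fits.mono {inp : Input} {s : Memory} {i B B' : ℕ} (hB : B ≤ B') {τ : Ty}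
    {e : Expr τ} (h : e.Fits inp s i B) : e.Fits inp s i B' := by
  induction e with
  | idx => exact le_trans h hB
  | wconst => exact le_trans h hB
  | rconst => trivial
  | wmem a iha => exact ⟨iha h.1, h.2.trans hB⟩
  | rmem a iha => exact iha h
  | winp a iha => exact ⟨iha h.1, h.2.trans hB⟩
  | rinp a iha => exact iha h
  | wop o a b iha ihb => exact ⟨iha h.1, ihb h.2.1, h.2.2.trans hB⟩
  | rop o a b iha ihb => exact ⟨iha h.1, ihb h.2⟩
  | cast a iha => exact iha h
  | wle a b iha ihb => exact ⟨iha h.1, ihb h.2⟩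
  | rle a b iha ihb => exact ⟨iha h.1, ihb h.2⟩
  | not a iha => exact iha h
  | and a b iha ihb => exact ⟨iha h.1, ihb h.2⟩
  | wite c a b ihc iha ihb => exact ⟨ihc h.1, fun hc => iha (h.2.1 hc), fun hc => ihb (h.2.2 hc)⟩
  | rite c a b ihc iha ihb => exact ⟨ihc h.1, fun hc => iha (h.2.1 hc), fun hc => ihb (h.2.2 hc)⟩

theorem instIdx_eval (inp : Input) (s : Memory) (i : ℕ) (e : Expr .word) {τ : Ty} (f : Expr τ) :
    (instIdx e f).eval inp s i = f.eval inp s (e.eval inp s i) := by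
  induction f <;> simp_all [instIdx, Expr.eval]

theorem instIdx_fits {inp : Input} {s : Memory} {i B : ℕ} {e : Expr .word}
    (he : e.Fits inp s i B) {τ : Ty} {f : Expr τ} (hf : f.Fits inp s (e.eval inp s i) B) :
    (instIdx e f).Fits inp s i B := by
  induction f <;> simp_all [instIdx, Expr.Fits, Expr.Holds, instIdx_eval]

section Redirect

variable {inp inp' : Input} {f : Expr .word} {g : Expr .real}

theorem redirect_eval (hf : ∀ s j, f.eval inp s j = inp'.words j)
    (hg : ∀ s j, g.eval inp s j = inp'.reals j) (s : Memory) (i : ℕ) {τ : Ty} (e : Expr τ) :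
    (redirect f g e).eval inp s i = e.eval inp' s i := by
  induction e <;> simp_all [redirect, Expr.eval, instIdx_eval]

/-- An address that fits within `B` is itself at most `B`, so the codes have to be bounded only at
arguments up to `B`. -/
theorem redirect_fits {B B' : ℕ} (hB : B ≤ B') (hf : ∀ s j, f.eval inp s j = inp'.words j)
    (hg : ∀ s j, g.eval inp s j = inp'.reals j) (hf' : ∀ s, ∀ j ≤ B, f.Fits inp s j B')
    (hg' : ∀ s, ∀ j ≤ B, g.Fits inp s j B') (s : Memory) (i : ℕ) {τ : Ty} {e : Expr τ}
    (h : e.Fits inp' s i B) : (redirect f g e).Fits inp s i B' := by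
  have ev := fun τ (e : Expr τ) => redirect_eval hf hg s i e
  induction e with
  | idx => exact le_trans h hB
  | wconst => exact le_trans h hB
  | rconst => trivial
  | wmem a iha =>
    refine ⟨iha h.1, ?_⟩
    rw [ev]
    exact h.2.trans hB
  | rmem a iha => exact iha h
  | winp a iha =>
    refine instIdx_fits (iha h.1) ?_
    rw [ev]
    exact hf' s _ (Expr.eval_le_of_fits a h.1)
  | rinp a iha =>
    refine instIdx_fits (iha h) ?_
    rw [ev]
    exact hg' s _ (Expr.eval_le_of_fits a h)
  | wop o a b iha ihb =>
    refine ⟨iha h.1, ihb h.2.1, ?_⟩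
    rw [ev, ev]
    exact h.2.2.trans hB
  | rop o a b iha ihb => exact ⟨iha h.1, ihb h.2⟩
  | cast a iha => exact iha h
  | wle a b iha ihb => exact ⟨iha h.1, ihb h.2⟩
  | rle a b iha ihb => exact ⟨iha h.1, ihb h.2⟩
  | not a iha => exact iha h
  | and a b iha ihb => exact ⟨iha h.1, ihb h.2⟩
  | wite c a b ihc iha ihb =>
    refine ⟨ihc h.1, fun hc => iha (h.2.1 ?_), fun hc => ihb (h.2.2 ?_)⟩
    all_goals simpa [Expr.Holds, ev] using hc
  | rite c a b ihc iha ihb =>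
    refine ⟨ihc h.1, fun hc => iha (h.2.1 ?_), fun hc => ihb (h.2.2 ?_)⟩
    all_goals simpa [Expr.Holds, ev] using hc

theorem exec_redirectProgram {B B' : ℕ} (hB : B ≤ B')
    (hf : ∀ s j, f.eval inp s j = inp'.words j) (hg : ∀ s j, g.eval inp s j = inp'.reals j)
    (hf' : ∀ s, ∀ j ≤ B, f.Fits inp s j B') (hg' : ∀ s, ∀ j ≤ B, g.Fits inp s j B')
    {p : Program} {s s' : Memory} {t : ℕ} (h : Exec inp' B p s t s') :
    Exec inp B' (redirectProgram f g p) s t s' := by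
  have ev := fun s τ (e : Expr τ) => redirect_eval hf hg s 0 e
  have fits := fun s τ (e : Expr τ) => redirect_fits hB hf hg hf' hg' s 0 (e := e)
  have holds : ∀ s (c : Expr .bool), (redirect f g c).Holds inp s 0 ↔ c.Holds inp' s 0 :=
    fun s c => by simp [Expr.Holds, ev]
  induction h with
  | wset ha he =>
    have := Exec.wset (fits _ _ _ ha) (fits _ _ _ he)
    rwa [ev, ev] at this
  | rset ha he =>
    have := Exec.rset (fits _ _ _ ha) (fits _ _ _ he)
    rwa [ev, ev] at this
  | seq _ _ ih ih' => exact .seq ih ih'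
  | ite_true hc hh _ ih => exact .ite_true (fits _ _ _ hc) ((holds _ _).2 hh) ih
  | ite_false hc hh _ ih => exact .ite_false (fits _ _ _ hc) (mt (holds _ _).1 hh) ih
  | loop_done hc hh => exact .loop_done (fits _ _ _ hc) (mt (holds _ _).1 hh)
  | loop_step hc hh _ _ ih ih' => exact .loop_step (fits _ _ _ hc) ((holds _ _).2 hh) ih ih'

end Redirect

/-- Needed for the final assignment of a local reduction, which reads the memory that the run leaves
behind. -/
theorem Exec.words_le {inp : Input} {B : ℕ} {p : Program} {s s' : Memory} {t : ℕ}
    (h : Exec inp B p s t s') (hs : ∀ a, s.words a ≤ B) (a : ℕ) : s'.words a ≤ B := by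
  induction h generalizing a with
  | wset ha he =>
    simp only [Function.update_apply]
    split_ifs
    exacts [Expr.eval_le_of_fits _ he, hs a]
  | rset => exact hs a
  | seq _ _ ih ih' => exact ih' (ih hs) a
  | ite_true _ _ _ ih => exact ih hs a
  | ite_false _ _ _ ih => exact ih hs a
  | loop_done => exact hs a
  | loop_step _ _ _ _ ih ih' => exact ih' (ih hs) a

/-! ### Functions that are computed by local code on clique inputs -/

/-- A graph together with the address of an input cell of the instance constructed from it. -/
structure CliqueQuery where
  n : ℕ
  G : SimpleGraph (Fin n)
  i : ℕ

/-- On clique inputs, the evaluation of the expression at polynomially bounded addresses involves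
polynomially bounded words only. -/
def Expr.PolyFits {τ : Ty} (e : Expr τ) : Prop :=
  ∀ c : ℕ, ∃ c' : ℕ, ∀ (x : CliqueQuery) (s : Memory), x.i ≤ (x.n + 2) ^ c →
    e.Fits (cliqueInput x.G) s x.i ((x.n + 2) ^ c')

/-- The word-valued function is computed by local code with polynomially bounded words. -/
def WordFn (F : CliqueQuery → ℕ) : Prop :=
  ∃ e : Expr .word, e.MemFree ∧ (∀ x s, e.eval (cliqueInput x.G) s x.i = F x) ∧ e.PolyFits

/-- The real-valued function is computed by local code with polynomially bounded words. -/
def RealFn (F : CliqueQuery → ℝ) : Prop :=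
  ∃ e : Expr .real, e.MemFree ∧ (∀ x s, e.eval (cliqueInput x.G) s x.i = F x) ∧ e.PolyFits

/-- The condition is decided by local code with polynomially bounded words. -/
def CondFn (p : CliqueQuery → Prop) : Prop :=
  ∃ e : Expr .bool, e.MemFree ∧ (∀ x s, e.Holds (cliqueInput x.G) s x.i ↔ p x) ∧ e.PolyFits

/-- The integer-valued function is, as a real number, computed by local code. -/
def IntFn (F : CliqueQuery → ℤ) : Prop :=
  RealFn fun x => (F x : ℝ)

theorem pow_le_pow_max_left (n a b : ℕ) : (n + 2) ^ a ≤ (n + 2) ^ max a b :=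
  Nat.pow_le_pow_right (by omega) (le_max_left a b)

theorem pow_le_pow_max_right (n a b : ℕ) : (n + 2) ^ b ≤ (n + 2) ^ max a b :=
  Nat.pow_le_pow_right (by omega) (le_max_right a b)

theorem Expr.PolyFits.both {σ τ : Ty} {a : Expr σ} {b : Expr τ} (ha : a.PolyFits)
    (hb : b.PolyFits) (c : ℕ) : ∃ c' : ℕ, ∀ (x : CliqueQuery) (s : Memory), x.i ≤ (x.n + 2) ^ c →
      a.Fits (cliqueInput x.G) s x.i ((x.n + 2) ^ c') ∧
      b.Fits (cliqueInput x.G) s x.i ((x.n + 2) ^ c') := by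
  obtain ⟨c₁, h₁⟩ := ha c
  obtain ⟨c₂, h₂⟩ := hb c
  exact ⟨max c₁ c₂, fun x s hx => ⟨(h₁ x s hx).mono (pow_le_pow_max_left _ _ _),
    (h₂ x s hx).mono (pow_le_pow_max_right _ _ _)⟩⟩

theorem Expr.PolyFits.three {σ τ υ : Ty} {a : Expr σ} {b : Expr τ} {e : Expr υ} (ha : a.PolyFits)
    (hb : b.PolyFits) (he : e.PolyFits) (c : ℕ) :
    ∃ c' : ℕ, ∀ (x : CliqueQuery) (s : Memory), x.i ≤ (x.n + 2) ^ c →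
      a.Fits (cliqueInput x.G) s x.i ((x.n + 2) ^ c') ∧
      b.Fits (cliqueInput x.G) s x.i ((x.n + 2) ^ c') ∧
      e.Fits (cliqueInput x.G) s x.i ((x.n + 2) ^ c') := by
  obtain ⟨c₁, h₁⟩ := ha c
  obtain ⟨c₂, h₂⟩ := hb.both he c
  exact ⟨max c₁ c₂, fun x s hx => ⟨(h₁ x s hx).mono (pow_le_pow_max_left _ _ _),
    (h₂ x s hx).1.mono (pow_le_pow_max_right _ _ _),
    (h₂ x s hx).2.mono (pow_le_pow_max_right _ _ _)⟩⟩

/-- Each operation raises the word bound to a fixed power at most, so an expression of fixed size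
keeps words polynomial. -/
theorem WordFn.op (o : WordOp) (k : ℕ) (ho : ∀ a b B : ℕ, 2 ≤ B → a ≤ B → b ≤ B →
    o.eval a b ≤ B ^ (k + 1)) {F H : CliqueQuery → ℕ} (hF : WordFn F) (hH : WordFn H) :
    WordFn fun x => o.eval (F x) (H x) := by
  obtain ⟨a, ma, ea, fa⟩ := hF
  obtain ⟨b, mb, eb, fb⟩ := hH
  refine ⟨.wop o a b, ⟨ma, mb⟩, fun x s => by simp only [Expr.eval, ea, eb], fun c => ?_⟩
  obtain ⟨c', h⟩ := fa.both fb c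
  -- The exponent `c' + 1` instead of `c'` makes the bound at least `2`, as `ho` demands.
  refine ⟨(c' + 1) * (k + 1), fun x s hx => ?_⟩
  obtain ⟨h₁, h₂⟩ := h x s hx
  have hB : (x.n + 2) ^ c' ≤ (x.n + 2) ^ (c' + 1) := Nat.pow_le_pow_right (by omega) (by omega)
  have hB' : (x.n + 2) ^ (c' + 1) ≤ (x.n + 2) ^ ((c' + 1) * (k + 1)) :=
    Nat.pow_le_pow_right (by omega) (Nat.le_mul_of_pos_right _ (by omega))
  refine ⟨h₁.mono (hB.trans hB'), h₂.mono (hB.trans hB'), ?_⟩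
  rw [pow_mul]
  refine ho _ _ _ ?_ ((Expr.eval_le_of_fits a h₁).trans hB) ((Expr.eval_le_of_fits b h₂).trans hB)
  calc 2 ≤ x.n + 2 := by omega
    _ ≤ (x.n + 2) ^ (c' + 1) := Nat.le_self_pow (by omega) _

theorem WordFn.index : WordFn fun x => x.i :=
  ⟨.idx, trivial, fun _ _ => rfl, fun c => ⟨c, fun _ _ hx => hx⟩⟩

theorem WordFn.const (k : ℕ) : WordFn fun _ => k :=
  ⟨.wconst k, trivial, fun _ _ => rfl, fun _ => ⟨k, fun x _ _ =>
    (Nat.lt_two_pow_self.le).trans (Nat.pow_le_pow_left (by omega) k)⟩⟩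

theorem WordFn.vertices : WordFn fun x => x.n := by
  refine ⟨.winp (.wconst 0), trivial, fun x s => by simp [Expr.eval, cliqueInput],
    fun _ => ⟨1, fun x s _ => ⟨Nat.zero_le _, ?_⟩⟩⟩
  simp [Expr.eval, cliqueInput]

/-! ### Closure properties of locally computable functions -/

section Closure

variable {F H : CliqueQuery → ℕ} {p q : CliqueQuery → Prop}

theorem WordFn.add (hF : WordFn F) (hH : WordFn H) : WordFn fun x => F x + H x :=
  WordFn.op .add 1 (fun a b B h ha hb => by
    simp only [WordOp.eval, one_add_one_eq_two, pow_two]; nlinarith) hF hH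

theorem WordFn.sub (hF : WordFn F) (hH : WordFn H) : WordFn fun x => F x - H x :=
  WordFn.op .sub 0 (fun a b B h ha hb => by
    simp only [WordOp.eval, zero_add, pow_one]; omega) hF hH

theorem WordFn.mul (hF : WordFn F) (hH : WordFn H) : WordFn fun x => F x * H x :=
  WordFn.op .mul 1 (fun a b B h ha hb => by
    simp only [WordOp.eval, one_add_one_eq_two, pow_two]; nlinarith) hF hH

theorem WordFn.div (hF : WordFn F) (hH : WordFn H) : WordFn fun x => F x / H x :=
  WordFn.op .div 0 (fun a b B h ha hb => by
    simpa [WordOp.eval] using (Nat.div_le_self a b).trans ha) hF hH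

theorem WordFn.mod (hF : WordFn F) (hH : WordFn H) : WordFn fun x => F x % H x :=
  WordFn.op .mod 0 (fun a b B h ha hb => by
    simpa [WordOp.eval] using (Nat.mod_le a b).trans ha) hF hH

theorem WordFn.pow (hF : WordFn F) (k : ℕ) : WordFn fun x => F x ^ k := by
  induction k with
  | zero => simpa using WordFn.const 1
  | succ k ih => simpa only [pow_succ] using ih.mul hF

/-- The number `k` of terms does not depend on the graph, so the sum unrolls into one loop-free
expression. -/
theorem WordFn.sum_range {F : CliqueQuery → ℕ → ℕ} (k : ℕ)
    (hF : ∀ r < k, WordFn fun x => F x r) :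
    WordFn fun x => ∑ r ∈ Finset.range k, F x r := by
  induction k with
  | zero => simpa using WordFn.const 0
  | succ k ih =>
    simpa only [Finset.sum_range_succ] using
      (ih fun r hr => hF r (hr.trans (Nat.lt_succ_self k))).add (hF k (Nat.lt_succ_self k))

theorem CondFn.le (hF : WordFn F) (hH : WordFn H) : CondFn fun x => F x ≤ H x := by
  obtain ⟨a, ma, ea, fa⟩ := hF
  obtain ⟨b, mb, eb, fb⟩ := hH
  exact ⟨.wle a b, ⟨ma, mb⟩, fun x s => by simp [Expr.Holds, Expr.eval, ea, eb], fa.both fb⟩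

theorem CondFn.not (hp : CondFn p) : CondFn fun x => ¬ p x := by
  obtain ⟨a, ma, ea, fa⟩ := hp
  refine ⟨.not a, ma, fun x s => ?_, fa⟩
  simp only [← ea x s]
  simp [Expr.Holds, Expr.eval]

theorem CondFn.and (hp : CondFn p) (hq : CondFn q) : CondFn fun x => p x ∧ q x := by
  obtain ⟨a, ma, ea, fa⟩ := hp
  obtain ⟨b, mb, eb, fb⟩ := hq
  refine ⟨.and a b, ⟨ma, mb⟩, fun x s => ?_, fa.both fb⟩
  simp only [← ea x s, ← eb x s]
  simp [Expr.Holds, Expr.eval]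

theorem CondFn.or (hp : CondFn p) (hq : CondFn q) : CondFn fun x => p x ∨ q x := by
  simpa only [← or_iff_not_and_not] using (hp.not.and hq.not).not

theorem CondFn.imp (hp : CondFn p) (hq : CondFn q) : CondFn fun x => p x → q x := by
  simpa only [imp_iff_not_or] using hp.not.or hq

theorem CondFn.eq (hF : WordFn F) (hH : WordFn H) : CondFn fun x => F x = H x := by
  simpa only [← le_antisymm_iff] using (CondFn.le hF hH).and (CondFn.le hH hF)

theorem CondFn.lt (hF : WordFn F) (hH : WordFn H) : CondFn fun x => F x < H x := by
  simpa only [not_le] using (CondFn.le hH hF).not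

theorem CondFn.const (P : Prop) : CondFn fun _ => P := by
  by_cases h : P
  · simpa [h] using CondFn.le (WordFn.const 0) (WordFn.const 0)
  · simpa [h] using CondFn.le (WordFn.const 1) (WordFn.const 0)

theorem CondFn.exists_lt {p : CliqueQuery → ℕ → Prop} (k : ℕ)
    (hp : ∀ r < k, CondFn fun x => p x r) : CondFn fun x => ∃ r < k, p x r := by
  induction k with
  | zero => simpa using CondFn.const False
  | succ k ih =>
    have h := (ih fun r hr => hp r (hr.trans (Nat.lt_succ_self k))).or (hp k (Nat.lt_succ_self k))
    have e : ∀ x, (∃ r < k + 1, p x r) ↔ (∃ r < k, p x r) ∨ p x k := fun x =>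
      Nat.exists_lt_succ_right
    simpa only [e] using h

theorem CondFn.forall_lt {p : CliqueQuery → ℕ → Prop} (k : ℕ)
    (hp : ∀ r < k, CondFn fun x => p x r) : CondFn fun x => ∀ r < k, p x r := by
  have h := (CondFn.exists_lt k fun r hr => (hp r hr).not).not
  simpa only [not_exists, not_and, not_not] using h

theorem WordFn.ite {dec : ∀ x, Decidable (p x)} (hp : CondFn p) (hF : WordFn F) (hH : WordFn H) :
    WordFn fun x => if p x then F x else H x := by
  obtain ⟨a, ma, ea, fa⟩ := hF
  obtain ⟨b, mb, eb, fb⟩ := hH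
  obtain ⟨e, me, ee, fe⟩ := hp
  refine ⟨.wite e a b, ⟨me, ma, mb⟩, fun x s => ?_, fun c => ?_⟩
  · have h := ee x s
    simp only [Expr.Holds] at h
    by_cases hx : p x
    · simp [Expr.eval, h.2 hx, hx, ea]
    · have h' : e.eval (cliqueInput x.G) s x.i = false := by simpa using mt h.1 hx
      simp [Expr.eval, h', hx, eb]
  · obtain ⟨c', h⟩ := fe.three fa fb c
    exact ⟨c', fun x s hx => ⟨(h x s hx).1, fun _ => (h x s hx).2.1, fun _ => (h x s hx).2.2⟩⟩

theorem RealFn.ite {F H : CliqueQuery → ℝ} {dec : ∀ x, Decidable (p x)} (hp : CondFn p)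
    (hF : RealFn F) (hH : RealFn H) :
    RealFn fun x => if p x then F x else H x := by
  obtain ⟨a, ma, ea, fa⟩ := hF
  obtain ⟨b, mb, eb, fb⟩ := hH
  obtain ⟨e, me, ee, fe⟩ := hp
  refine ⟨.rite e a b, ⟨me, ma, mb⟩, fun x s => ?_, fun c => ?_⟩
  · have h := ee x s
    simp only [Expr.Holds] at h
    by_cases hx : p x
    · simp [Expr.eval, h.2 hx, hx, ea]
    · have h' : e.eval (cliqueInput x.G) s x.i = false := by simpa using mt h.1 hx
      simp [Expr.eval, h', hx, eb]
  · obtain ⟨c', h⟩ := fe.three fa fb c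
    exact ⟨c', fun x s hx => ⟨(h x s hx).1, fun _ => (h x s hx).2.1, fun _ => (h x s hx).2.2⟩⟩

theorem RealFn.op (o : RealOp) {F H : CliqueQuery → ℝ} (hF : RealFn F) (hH : RealFn H) :
    RealFn fun x => o.eval (F x) (H x) := by
  obtain ⟨a, ma, ea, fa⟩ := hF
  obtain ⟨b, mb, eb, fb⟩ := hH
  exact ⟨.rop o a b, ⟨ma, mb⟩, fun x s => by simp only [Expr.eval, ea, eb], fa.both fb⟩

theorem WordFn.realCast (hF : WordFn F) : RealFn fun x => (F x : ℝ) := by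
  obtain ⟨a, ma, ea, fa⟩ := hF
  exact ⟨.cast a, ma, fun x s => by simp only [Expr.eval, ea], fa⟩

theorem WordFn.intCast (hF : WordFn F) : IntFn fun x => (F x : ℤ) := by
  simpa only [IntFn, Int.cast_natCast] using hF.realCast

theorem IntFn.const (k : ℤ) : IntFn fun _ => k :=
  ⟨.rconst k, trivial, fun _ _ => by simp [Expr.eval], fun _ => ⟨0, fun _ _ _ => trivial⟩⟩

theorem IntFn.add {F H : CliqueQuery → ℤ} (hF : IntFn F) (hH : IntFn H) :
    IntFn fun x => F x + H x := by
  simpa only [IntFn, Int.cast_add, RealOp.eval] using RealFn.op .add hF hH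

theorem IntFn.sub {F H : CliqueQuery → ℤ} (hF : IntFn F) (hH : IntFn H) :
    IntFn fun x => F x - H x := by
  simpa only [IntFn, Int.cast_sub, RealOp.eval] using RealFn.op .sub hF hH

theorem IntFn.mul {F H : CliqueQuery → ℤ} (hF : IntFn F) (hH : IntFn H) :
    IntFn fun x => F x * H x := by
  simpa only [IntFn, Int.cast_mul, RealOp.eval] using RealFn.op .mul hF hH

theorem IntFn.ite {F H : CliqueQuery → ℤ} {dec : ∀ x, Decidable (p x)} (hp : CondFn p)
    (hF : IntFn F) (hH : IntFn H) :
    IntFn fun x => if p x then F x else H x := by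
  have h := RealFn.ite (dec := dec) hp hF hH
  simpa only [IntFn, apply_ite (Int.cast : ℤ → ℝ)] using h

end Closure

/-- Adjacency of vertices that are given by natural numbers. -/
def AdjNat {n : ℕ} (G : SimpleGraph (Fin n)) (u w : ℕ) : Prop :=
  ∃ (hu : u < n) (hw : w < n), G.Adj ⟨u, hu⟩ ⟨w, hw⟩

/-- Division with remainder by `n` recovers `u` and `w` from the address. For `u ≥ n` the address
lies behind the matrix and both sides are false, so only `w` needs a bound. -/
theorem one_le_cliqueInput_words {n : ℕ} (G : SimpleGraph (Fin n)) {u w : ℕ}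
    (hw : w < n) : 1 ≤ (cliqueInput G).words (1 + (u * n + w)) ↔ AdjNat G u w := by
  have key : (∃ i j : Fin n, 1 + (u * n + w) = 1 + (i * n + j) ∧ G.Adj i j) ↔ AdjNat G u w := by
    constructor
    · rintro ⟨⟨i, hi⟩, ⟨j, hj⟩, h, hG⟩
      have h' : u * n + w = i * n + j := by simpa using h
      have hn : 0 < n := by omega
      have e₁ : u = i := by
        have := congrArg (· / n) h'
        simpa [Nat.mul_comm _ n, Nat.mul_add_div hn, Nat.div_eq_of_lt hw,
          Nat.div_eq_of_lt hj] using this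
      subst e₁
      have e₂ : w = j := by omega
      subst e₂
      exact ⟨hi, hj, hG⟩
    · rintro ⟨hu, hw, h⟩
      exact ⟨_, _, rfl, h⟩
  simp only [cliqueInput, key]
  rw [if_neg (by omega)]
  split_ifs with h
  · exact iff_of_true le_rfl (key.1 h)
  · exact iff_of_false (by omega) (mt key.2 h)

theorem CondFn.adjNat {F H : CliqueQuery → ℕ} (hF : WordFn F) (hH : WordFn H) :
    CondFn fun x => AdjNat x.G (F x) (H x) := by
  have hentry : CondFn fun x =>
      1 ≤ (cliqueInput x.G).words (1 + (F x * x.n + H x)) := by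
    obtain ⟨a, ma, ea, fa⟩ := (WordFn.const 1).add ((hF.mul .vertices).add hH)
    refine ⟨.wle (.wconst 1) (.winp a), ⟨trivial, ma⟩, fun x s => ?_, fun c => ?_⟩
    · simp only [Expr.Holds, Expr.eval, ea]
      simp
    · obtain ⟨c', h⟩ := fa c
      refine ⟨max 1 c', fun x s hx => ⟨?_, (h x s hx).mono (pow_le_pow_max_right _ _ _), ?_⟩⟩
      · exact Nat.one_le_pow _ _ (by omega)
      · refine le_trans ?_ (pow_le_pow_max_left _ _ _)
        simp only [cliqueInput, pow_one]
        split_ifs <;> simp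
  have h := (CondFn.lt hF .vertices).and ((CondFn.lt hH .vertices).and hentry)
  convert h using 2 with x
  constructor
  · rintro ⟨hu, hw, hG⟩
    exact ⟨hu, hw, (one_le_cliqueInput_words x.G hw).2 ⟨hu, hw, hG⟩⟩
  · rintro ⟨hu, hw, hG⟩
    exact (one_le_cliqueInput_words x.G hw).1 hG

/-! ### Digits -/

/-- The digit of `x` in base `A` at place `r`. -/
def digitAt (A r x : ℕ) : ℕ :=
  x / A ^ r % A

theorem digitAt_lt {A : ℕ} (hA : 0 < A) (r x : ℕ) : digitAt A r x < A :=
  Nat.mod_lt _ hA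

theorem digitAt_mod_pow (A x : ℕ) {r k : ℕ} (h : r < k) :
    digitAt A r (x % A ^ k) = digitAt A r x := by
  obtain ⟨l, rfl⟩ : ∃ l, k = r + (l + 1) := ⟨k - r - 1, by omega⟩
  rw [digitAt, digitAt, pow_add, Nat.mod_mul_right_div_self, Nat.mod_mod_of_dvd]
  exact dvd_pow_self A (by omega)

/-- The number with the given digits in base `A`. -/
def ofDigitFn (A k : ℕ) (e : ℕ → ℕ) : ℕ :=
  ∑ r ∈ Finset.range k, e r * A ^ r

theorem ofDigitFn_lt {A k : ℕ} {e : ℕ → ℕ} (he : ∀ r < k, e r < A) :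
    ofDigitFn A k e < A ^ k := by
  induction k with
  | zero => simp [ofDigitFn]
  | succ k ih =>
    have h := ih fun r hr => he r (by omega)
    have h' : e k + 1 ≤ A := he k (by omega)
    simp only [ofDigitFn, Finset.sum_range_succ, pow_succ] at h ⊢
    nlinarith [Nat.mul_le_mul_right (A ^ k) h']

theorem digitAt_ofDigitFn {A k r : ℕ} {e : ℕ → ℕ} (he : ∀ r < k, e r < A) (hr : r < k) :
    digitAt A r (ofDigitFn A k e) = e r := by
  induction k with
  | zero => omega
  | succ k ih =>
    have h := ofDigitFn_lt (k := k) fun r hr => he r (by omega)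
    have hs : ofDigitFn A (k + 1) e = ofDigitFn A k e + e k * A ^ k := by
      simp [ofDigitFn, Finset.sum_range_succ]
    rw [hs]
    rcases Nat.lt_succ_iff_lt_or_eq.1 hr with hr | rfl
    · rw [← digitAt_mod_pow A _ hr, Nat.add_mul_mod_self_right, Nat.mod_eq_of_lt h]
      exact ih (fun r hr => he r (by omega)) hr
    · rw [digitAt, Nat.add_mul_div_right _ _ (by omega), Nat.div_eq_of_lt h, zero_add,
        Nat.mod_eq_of_lt (he r (by omega))]

theorem ofDigitFn_digitAt (A k x : ℕ) : ofDigitFn A k (digitAt A · x) = x % A ^ k := by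
  induction k with
  | zero => simp [ofDigitFn, Nat.mod_one]
  | succ k ih =>
    simp only [ofDigitFn, Finset.sum_range_succ] at ih ⊢
    rw [ih, Nat.mod_pow_succ, digitAt, mul_comm (A ^ k)]

theorem ofDigitFn_injective {A k : ℕ} {e e' : ℕ → ℕ} (he : ∀ r < k, e r < A)
    (he' : ∀ r < k, e' r < A) (h : ofDigitFn A k e = ofDigitFn A k e') {r : ℕ} (hr : r < k) :
    e r = e' r := by
  rw [← digitAt_ofDigitFn he hr, h, digitAt_ofDigitFn he' hr]

theorem ofDigitFn_congr {A k : ℕ} {e e' : ℕ → ℕ} (h : ∀ r < k, e r = e' r) :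
    ofDigitFn A k e = ofDigitFn A k e' :=
  Finset.sum_congr rfl fun r hr => by rw [h r (Finset.mem_range.1 hr)]

/-- No bound on the digits is needed here; absence of carries matters only when digits are read back
by `ofDigitFn_injective`. -/
theorem ofDigitFn_add (A k : ℕ) (e e' : ℕ → ℕ) :
    ofDigitFn A k (fun r => e r + e' r) = ofDigitFn A k e + ofDigitFn A k e' := by
  simp [ofDigitFn, add_mul, Finset.sum_add_distrib]

/-! ### The instance of the decision problem -/

/-- The parameters of the reduction: a `d * ℓ`-clique is encoded by `d` numbers with `ℓ` digits in
base `A`, the lowest `ℓ₁` of which are distributed over points and hypercubes. -/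
structure Layout where
  d : ℕ
  ℓ : ℕ
  ℓ₁ : ℕ
  A : ℕ

namespace Layout

variable (L : Layout)

/-- The number of possible values of a coordinate of the translation vector. -/
def range : ℕ := L.A ^ L.ℓ

/-- The number of possible values of the lowest `ℓ₁` digits. -/
def lowRange : ℕ := L.A ^ L.ℓ₁

/-- The place of the gadget of the point or hypercube with number `z`. -/
def gadget (z : ℕ) : ℕ := z % L.A ^ 4

/-- The two coordinates which the gadget is about. -/
def fstCoord (z : ℕ) : ℕ := digitAt L.A 0 z
def sndCoord (z : ℕ) : ℕ := digitAt L.A 1 z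

/-- The two digit places which the gadget is about. -/
def fstPlace (z : ℕ) : ℕ := digitAt L.A 2 z
def sndPlace (z : ℕ) : ℕ := digitAt L.A 3 z

/-- For hypercubes: `0` and `1` are the lower and upper quadrants of a staircase, `2` and `3` the
half-spaces on either side, `4` lies in slot `0`. For points: only kind `0` can be active; kinds
`1`, `2`, `3` serve to confine the translation vector. -/
def kind (z : ℕ) : ℕ := digitAt L.A 4 z

/-- The digits of the shift of a point in the second coordinate of its gadget. -/
def sndDigit (z r : ℕ) : ℕ := digitAt L.A (5 + r) z

/-- The digits of the shift of a point in the first coordinate of its gadget. -/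
def fstDigit (z r : ℕ) : ℕ :=
  if L.fstCoord z = L.sndCoord z then L.sndDigit z r
  else if r < L.ℓ₁ then
    if r = L.fstPlace z then digitAt L.A (5 + (2 * L.ℓ - L.ℓ₁)) z
    else if r = L.sndPlace z then digitAt L.A (6 + (2 * L.ℓ - L.ℓ₁)) z
    else 0
  else digitAt L.A (5 + L.ℓ + (r - L.ℓ₁)) z

def fstShift (z : ℕ) : ℕ := ofDigitFn L.A L.ℓ (L.fstDigit z)
def sndShift (z : ℕ) : ℕ := ofDigitFn L.A L.ℓ (L.sndDigit z)

/-- The point excludes some translation vectors that do not encode cliques. -/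
def Active {n : ℕ} (G : SimpleGraph (Fin n)) (z : ℕ) : Prop :=
  L.kind z = 0 ∧ L.fstCoord z < L.d ∧ L.sndCoord z < L.d ∧
    ∃ i < L.ℓ, L.fstPlace z = i ∧ ∃ j < L.ℓ, L.sndPlace z = j ∧
      ¬ (L.fstCoord z = L.sndCoord z ∧ i = j) ∧ ¬ AdjNat G (L.fstDigit z i) (L.sndDigit z j)

open Classical in
-- Gadgets occupy the slots `1` to `A ^ 4`. The two outer slots keep the translation from moving
-- points to other slots; the last one also takes the points with nothing to exclude.
noncomputable def pointSlot {n : ℕ} (G : SimpleGraph (Fin n)) (z : ℕ) : ℕ :=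
  if L.Active G z then 1 + L.gadget z else if L.kind z = 2 then 0 else L.A ^ 4 + 1

open Classical in
-- The factor `4` leaves room for rounding and perturbation. In the last slot, the local positions
-- `0` and `28 * range + 2` confine each coordinate from below and from above.
noncomputable def pointLocal {n : ℕ} (G : SimpleGraph (Fin n)) (z c : ℕ) : ℤ :=
  if L.Active G z then
    if c = L.sndCoord z then 0 - 4 * L.sndShift z
    else if c = L.fstCoord z then 0 - 4 * L.fstShift z
    else 0
  else if L.kind z = 1 then 28 * L.range + 2
  else 0

/-- Coordinate `c` of the point with number `z`, up to scaling and perturbation. -/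
noncomputable def pointCoord {n : ℕ} (G : SimpleGraph (Fin n)) (z c : ℕ) : ℤ :=
  (if c = 0 then 256 * L.range * L.pointSlot G z else 0) + L.pointLocal G z c

/-- The parameter of a hypercube in a gadget for two different coordinates. -/
def step (z : ℕ) : ℕ := z / L.A ^ 5 % L.lowRange

/-- The hypercubes of the gadget leave a hole at place `t` for graphs with `n` vertices. -/
def Hole (n z t : ℕ) : Prop :=
  ∀ r < L.ℓ₁, digitAt L.A r t < n ∧
    ((r = L.fstPlace z ∨ r = L.sndPlace z) → digitAt L.A r t = 0)

def cubeSlot (z : ℕ) : ℕ :=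
  if ((L.kind z = 0 ∨ L.kind z = 1) ∧ ¬ L.fstCoord z = L.sndCoord z) ∨
      L.kind z = 2 ∨ L.kind z = 3 then 1 + L.gadget z
  else if L.kind z = 4 then 0 else L.A ^ 4 + 1

open Classical in
-- The half-width is `16 * range`. In terms of integral offsets `u`, `w` with margin `1`, kind `0`
-- covers `u ≤ t`, `w ≤ -t` (`w ≤ -t - 1` at a hole), kind `1` covers `u ≥ t`, `w ≥ 1 - t`, kind `2`
-- covers `u ≤ -1`, and kind `3` covers `u ≥ lowRange`, or `u ≥ 1` for equal coordinates.
noncomputable def cubeLocal (n z c : ℕ) : ℤ :=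
  if L.kind z = 0 ∧ ¬ L.fstCoord z = L.sndCoord z then
    if c = L.fstCoord z then 4 * L.step z + 1 - 16 * L.range
    else if c = L.sndCoord z then
      1 - 4 * L.step z - (if L.Hole n z (L.step z) then 4 else 0) - 16 * L.range
    else 0
  else if L.kind z = 1 ∧ ¬ L.fstCoord z = L.sndCoord z then
    if c = L.fstCoord z then 4 * L.step z - 1 + 16 * L.range
    else if c = L.sndCoord z then 3 - 4 * L.step z + 16 * L.range
    else 0
  else if L.kind z = 2 then
    if c = L.fstCoord z then -3 - 16 * L.range else 0
  else if L.kind z = 3 then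
    if c = L.fstCoord z then
      4 * (if L.fstCoord z = L.sndCoord z then 1 else L.lowRange) - 1 + 16 * L.range
    else 0
  else 16 * L.range - 1

/-- Coordinate `c` of the centre of the hypercube with number `z`, up to scaling and
perturbation. -/
noncomputable def cubeCoord (n z c : ℕ) : ℤ :=
  (if c = 0 then 256 * L.range * L.cubeSlot z else 0) + L.cubeLocal n z c

/-- The conditions on the parameters under which the reduction is correct. -/
structure Valid (n : ℕ) : Prop where
  d_pos : 1 ≤ L.d
  d_le : L.d ≤ L.A
  ℓ_le : L.ℓ ≤ L.A
  two_le_ℓ : 2 ≤ L.ℓ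
  ℓ₁_le : L.ℓ₁ ≤ L.ℓ
  five_le : 5 ≤ L.A
  two_mul_le : 2 * n ≤ L.A

end Layout

/-- Only adjacency to another entry bounds an entry, hence the need for two indices. -/
theorem lt_of_pairwise_adjNat {ℓ n : ℕ} {G : SimpleGraph (Fin n)} (hℓ : 2 ≤ ℓ) {e : ℕ → ℕ}
    (he : ∀ i < ℓ, ∀ j < ℓ, i ≠ j → AdjNat G (e i) (e j)) {i : ℕ} (hi : i < ℓ) : e i < n := by
  obtain ⟨j, hj, hij⟩ : ∃ j < ℓ, i ≠ j := by
    rcases Nat.eq_zero_or_pos i with rfl | h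
    exacts [⟨1, by omega, by omega⟩, ⟨0, by omega, by omega⟩]
  exact (he i hi j hj hij).1

/-! ### From a clique to a translation that covers all points -/

namespace Layout

variable {L : Layout} {n : ℕ} {G : SimpleGraph (Fin n)}

theorem Valid.A_pos (hv : L.Valid n) : 0 < L.A := by
  have := hv.five_le
  omega

theorem gadget_eq (L : Layout) (z : ℕ) :
    L.gadget z = ofDigitFn L.A 4 (digitAt L.A · z) :=
  (ofDigitFn_digitAt L.A 4 z).symm

theorem digitAt_eq_of_gadget_eq {y z r : ℕ} (h : L.gadget y = L.gadget z) (hr : r < 4) :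
    digitAt L.A r y = digitAt L.A r z := by
  rw [← digitAt_mod_pow L.A y hr, ← digitAt_mod_pow L.A z hr]
  exact congrArg _ h

theorem fstDigit_lt (hv : L.Valid n) (z r : ℕ) : L.fstDigit z r < L.A := by
  have hA := hv.A_pos
  unfold fstDigit sndDigit
  split_ifs
  all_goals first | exact hA | exact digitAt_lt hA _ _

theorem sndDigit_lt (hv : L.Valid n) (z r : ℕ) : L.sndDigit z r < L.A :=
  digitAt_lt hv.A_pos _ _

theorem fstShift_lt (hv : L.Valid n) (z : ℕ) : L.fstShift z < L.range :=
  ofDigitFn_lt fun _ _ => fstDigit_lt hv z _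

theorem sndShift_lt (hv : L.Valid n) (z : ℕ) : L.sndShift z < L.range :=
  ofDigitFn_lt fun _ _ => sndDigit_lt hv z _

theorem step_lt (hv : L.Valid n) (z : ℕ) : L.step z < L.lowRange :=
  Nat.mod_lt _ (pow_pos hv.A_pos _)

theorem lowRange_le (hv : L.Valid n) : L.lowRange ≤ L.range :=
  Nat.pow_le_pow_right hv.A_pos hv.ℓ₁_le

theorem lowRange_pos (hv : L.Valid n) : 0 < L.lowRange :=
  pow_pos hv.A_pos _

/-- The hypercubes of every gadget are available. -/
theorem exists_cube (hv : L.Valid n) (z : ℕ) {k t : ℕ} (hk : k < 5) (ht : t < L.lowRange) :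
    ∃ y < L.A ^ (5 + L.ℓ₁), L.gadget y = L.gadget z ∧ L.fstCoord y = L.fstCoord z ∧
      L.sndCoord y = L.sndCoord z ∧ L.fstPlace y = L.fstPlace z ∧ L.sndPlace y = L.sndPlace z ∧
      L.kind y = k ∧ L.step y = t := by
  have hA := hv.A_pos
  -- The number wanted has the four gadget digits of `z`, then the digit `k`, then `t`.
  set h : ℕ → ℕ := fun r => if r = 4 then k else digitAt L.A r z with hdef
  have hh : ∀ r < 5, h r < L.A := by
    intro r _
    have := hv.five_le
    simp only [hdef]
    split_ifs
    exacts [by omega, digitAt_lt hA _ _]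
  have hlt := ofDigitFn_lt hh
  have hdig : ∀ r < 5, digitAt L.A r (ofDigitFn L.A 5 h + t * L.A ^ 5) = h r := by
    intro r hr
    rw [← digitAt_mod_pow L.A _ hr, Nat.add_mul_mod_self_right, Nat.mod_eq_of_lt hlt,
      digitAt_ofDigitFn hh hr]
  refine ⟨ofDigitFn L.A 5 h + t * L.A ^ 5, ?_, ?_, hdig 0 (by omega), hdig 1 (by omega),
    hdig 2 (by omega), hdig 3 (by omega), hdig 4 (by omega), ?_⟩
  · have ht' : t + 1 ≤ L.A ^ L.ℓ₁ := ht
    rw [pow_add]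
    nlinarith [Nat.mul_le_mul_right (L.A ^ 5) ht']
  · rw [gadget_eq, gadget_eq]
    refine ofDigitFn_congr fun r hr => ?_
    rw [hdig r (by omega)]
    simp [hdef, hr.ne]
  · rw [step, Nat.add_mul_div_right _ _ (pow_pos hA _), Nat.div_eq_of_lt hlt, zero_add,
      Nat.mod_eq_of_lt ht]

theorem abs_le_of_slot_eq {y z c : ℕ} {x B : ℤ} (h : L.pointSlot G z = L.cubeSlot y)
    (hx : |x + L.pointLocal G z c - L.cubeLocal n y c| ≤ B) :
    |x + L.pointCoord G z c - L.cubeCoord n y c| ≤ B := by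
  convert hx using 2
  rw [pointCoord, cubeCoord, h]
  ring

open Classical in
/-- If `x` encodes a clique, then every translated point is covered. -/
theorem exists_cube_of_clique (hv : L.Valid n) {e : ℕ → ℕ → ℕ}
    (he : ∀ a < L.d, ∀ b < L.d, ∀ i < L.ℓ, ∀ j < L.ℓ, ¬ (a = b ∧ i = j) →
      AdjNat G (e a i) (e b j)) (z : ℕ) :
    ∃ y < L.A ^ (5 + L.ℓ₁), ∀ c < L.d,
      |4 * (ofDigitFn L.A L.ℓ (e c) : ℤ) + L.pointCoord G z c - L.cubeCoord n y c| ≤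
        16 * L.range - 1 := by
  have hlt : ∀ a < L.d, ∀ i < L.ℓ, e a i < n := fun a ha i hi =>
    lt_of_pairwise_adjNat hv.two_le_ℓ
      (fun i hi j hj hij => he a ha a ha i hi j hj fun h => hij h.2) hi
  have hltA : ∀ a < L.d, ∀ i < L.ℓ, e a i < L.A := fun a ha i hi => by
    have := hlt a ha i hi
    have := hv.two_mul_le
    omega
  set x : ℕ → ℕ := fun c => ofDigitFn L.A L.ℓ (e c) with hxdef
  have hx : ∀ c < L.d, x c < L.range := fun c hc => ofDigitFn_lt (hltA c hc)
  change ∃ y < L.A ^ (5 + L.ℓ₁), ∀ c < L.d,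
      |4 * (x c : ℤ) + L.pointCoord G z c - L.cubeCoord n y c| ≤ 16 * L.range - 1
  have hX : L.lowRange ≤ L.range := lowRange_le hv
  have hY : 0 < L.lowRange := lowRange_pos hv
  have h1 := fstShift_lt hv z
  have h2 := sndShift_lt hv z
  by_cases hact : L.Active G z
  · have hps : L.pointSlot G z = 1 + L.gadget z := if_pos hact
    have hpl : ∀ c, L.pointLocal G z c = if c = L.sndCoord z then 0 - 4 * (L.sndShift z : ℤ)
        else if c = L.fstCoord z then 0 - 4 * (L.fstShift z : ℤ) else 0 := fun c => if_pos hact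
    obtain ⟨-, ha, hb, i, hi, hpi, j, hj, hpj, hne, hnadj⟩ := hact
    -- the hypercubes that bound the first coordinate from one side
    have left : x (L.fstCoord z) < L.fstShift z → (L.fstCoord z = L.sndCoord z →
        L.fstShift z = L.sndShift z) → ∃ y < L.A ^ (5 + L.ℓ₁), ∀ c < L.d,
        |4 * (x c : ℤ) + L.pointCoord G z c - L.cubeCoord n y c| ≤ 16 * L.range - 1 := by
      intro hlt' hsame
      obtain ⟨y, hy, hg, hya, hyb, -, -, hyk, -⟩ := exists_cube hv z (k := 2) (by omega) hY
      refine ⟨y, hy, fun c hc => abs_le_of_slot_eq ?_ ?_⟩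
      · simp [hps, cubeSlot, hyk, hg]
      · have := hx c hc
        simp only [hpl, cubeLocal, hyk, hya, OfNat.ofNat_ne_zero, OfNat.ofNat_ne_one, false_and,
          if_false, if_true]
        rw [abs_le]
        by_cases hca : c = L.fstCoord z
        · subst hca
          by_cases hcb : L.fstCoord z = L.sndCoord z
          · have := hsame hcb
            simp only [if_pos hcb, if_true]
            omega
          · simp only [if_neg hcb, if_true]
            omega
        · simp only [if_neg hca]
          split_ifs <;> omega
    have right : (if L.fstCoord z = L.sndCoord z then 1 else L.lowRange) + L.fstShift z ≤
        x (L.fstCoord z) → (L.fstCoord z = L.sndCoord z →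
        L.fstShift z = L.sndShift z) → ∃ y < L.A ^ (5 + L.ℓ₁), ∀ c < L.d,
        |4 * (x c : ℤ) + L.pointCoord G z c - L.cubeCoord n y c| ≤ 16 * L.range - 1 := by
      intro hle hsame
      obtain ⟨y, hy, hg, hya, hyb, -, -, hyk, -⟩ := exists_cube hv z (k := 3) (by omega) hY
      refine ⟨y, hy, fun c hc => abs_le_of_slot_eq ?_ ?_⟩
      · simp [hps, cubeSlot, hyk, hg]
      · have := hx c hc
        simp only [hpl, cubeLocal, hyk, hya, hyb, OfNat.ofNat_ne_zero, OfNat.ofNat_ne_one,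
          false_and, if_false, if_true, show ¬ (3 = 2) by omega]
        rw [abs_le]
        by_cases hca : c = L.fstCoord z
        · subst hca
          by_cases hcb : L.fstCoord z = L.sndCoord z
          · have := hsame hcb
            simp only [if_pos hcb, if_true] at hle ⊢
            omega
          · simp only [if_neg hcb, if_true] at hle ⊢
            omega
        · simp only [if_neg hca]
          split_ifs <;> omega
    by_cases hab : L.fstCoord z = L.sndCoord z
    · have hdig : ∀ r, L.fstDigit z r = L.sndDigit z r := fun r => if_pos hab
      have hsh : L.fstShift z = L.sndShift z := ofDigitFn_congr fun r _ => hdig r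
      rcases lt_trichotomy (x (L.fstCoord z)) (L.fstShift z) with h | h | h
      · exact left h fun _ => hsh
      -- In the gap, `x` has the digits of the shift, and two of those are non-adjacent.
      · have hd : ∀ r < L.ℓ, e (L.fstCoord z) r = L.fstDigit z r := fun r hr =>
          ofDigitFn_injective (hltA _ ha) (fun r _ => fstDigit_lt hv z r) h hr
        rw [← hd i hi, ← hdig j, ← hd j hj] at hnadj
        exact absurd (he _ ha _ ha i hi j hj fun h => hne ⟨hab, h.2⟩) hnadj
      · exact right (by rw [if_pos hab]; omega) fun _ => hsh
    · rcases Nat.lt_or_ge (x (L.fstCoord z)) (L.fstShift z) with h | h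
      · exact left h fun h => absurd h hab
      -- The offset in the first coordinate is `t`. Beyond `lowRange` a half-space covers; below,
      -- the staircases decide by the second coordinate.
      obtain ⟨t, ht⟩ := Nat.exists_eq_add_of_le h
      rcases Nat.lt_or_ge t L.lowRange with htY | htY
      swap
      · exact right (by rw [if_neg hab]; omega) fun h => absurd h hab
      -- Strictly above the antidiagonal, the upper quadrant with parameter `t` covers the point.
      by_cases hge : L.sndShift z + 1 ≤ x (L.sndCoord z) + t
      · obtain ⟨y, hy, hg, hya, hyb, -, -, hyk, hyt⟩ := exists_cube hv z (k := 1) (by omega) htY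
        refine ⟨y, hy, fun c hc => abs_le_of_slot_eq ?_ ?_⟩
        · simp [hps, cubeSlot, hyk, hg, hya, hyb, hab]
        · have := hx c hc
          simp only [hpl, cubeLocal, hyk, hya, hyb, hyt, hab, one_ne_zero, not_false_eq_true,
            and_true, if_false, if_true]
          rw [abs_le]
          by_cases hca : c = L.fstCoord z
          · subst hca
            simp only [if_neg hab, if_true]
            omega
          · simp only [if_neg hca]
            by_cases hcb : c = L.sndCoord z
            · subst hcb
              simp only [if_true]
              omega
            · simp only [if_neg hcb]
              omega
      -- On or below the antidiagonal the lower quadrant covers, except in a hole. A hole cannot be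
      -- hit: the digits at the two places would be those of the point, which are non-adjacent.
      · have hsw : x (L.sndCoord z) + t + (if L.Hole n z t then 1 else 0) ≤ L.sndShift z := by
          split_ifs with hhole
          swap
          · omega
          rcases (by omega : x (L.sndCoord z) + t + 1 ≤ L.sndShift z ∨
            x (L.sndCoord z) + t = L.sndShift z) with h' | h'
          · exact h'
          exfalso
          have htd : ofDigitFn L.A L.ℓ (digitAt L.A · t) = t := by
            exact (ofDigitFn_digitAt _ _ _).trans (Nat.mod_eq_of_lt (htY.trans_le hX))
          have htz : ∀ r, L.ℓ₁ ≤ r → digitAt L.A r t = 0 := fun r hr => by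
            rw [digitAt, Nat.div_eq_of_lt (htY.trans_le (Nat.pow_le_pow_right hv.A_pos hr)),
              Nat.zero_mod]
          have htn : ∀ r, digitAt L.A r t + n ≤ L.A ∧ ((r = L.fstPlace z ∨ r = L.sndPlace z) →
              digitAt L.A r t = 0) := by
            intro r
            have hnA := hv.two_mul_le
            rcases Nat.lt_or_ge r L.ℓ₁ with hr | hr
            · exact ⟨by have := (hhole r hr).1; omega, (hhole r hr).2⟩
            · exact ⟨by rw [htz r hr]; omega, fun _ => htz r hr⟩
          have hsnd : ∀ r < L.ℓ, e (L.sndCoord z) r + digitAt L.A r t = L.sndDigit z r :=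
            fun r hr => ofDigitFn_injective (A := L.A) (k := L.ℓ)
              (e := fun r => e (L.sndCoord z) r + digitAt L.A r t)
              (fun r hr => by have := hlt _ hb r hr; have := (htn r).1; omega)
              (fun r _ => sndDigit_lt hv z r)
              (by rw [ofDigitFn_add, htd]; exact h') hr
          -- No carries: where `t` has a nonzero digit, the place is below `ℓ₁` and differs from
          -- both gadget places, so the first shift has digit `0` there.
          have hfst : ∀ r < L.ℓ, e (L.fstCoord z) r = L.fstDigit z r + digitAt L.A r t := by
            refine fun r hr => ofDigitFn_injective (A := L.A) (k := L.ℓ)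
              (e' := fun r => L.fstDigit z r + digitAt L.A r t) (hltA _ ha)
              (fun r _ => ?_) (by rw [ofDigitFn_add, htd]; exact ht) hr
            by_cases hr0 : digitAt L.A r t = 0
            · rw [hr0]
              exact fstDigit_lt hv z r
            · have hr1 : r < L.ℓ₁ := lt_of_not_ge fun h => hr0 (htz r h)
              have hr2 := fun h => hr0 ((htn r).2 h)
              have : L.fstDigit z r = 0 := by
                rw [fstDigit, if_neg hab, if_pos hr1, if_neg fun h => hr2 (.inl h),
                  if_neg fun h => hr2 (.inr h)]
              rw [this, zero_add]
              exact digitAt_lt hv.A_pos _ _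
          refine hnadj ?_
          have e₁ := hfst i hi
          have e₂ := hsnd j hj
          rw [(htn i).2 (.inl hpi.symm), add_zero] at e₁
          rw [(htn j).2 (.inr hpj.symm), add_zero] at e₂
          rw [← e₁, ← e₂]
          exact he _ ha _ hb i hi j hj fun h => hab h.1
        obtain ⟨y, hy, hg, hya, hyb, hyi, hyj, hyk, hyt⟩ :=
          exists_cube hv z (k := 0) (by omega) htY
        have hH : L.Hole n y t ↔ L.Hole n z t := by simp only [Hole, hyi, hyj]
        refine ⟨y, hy, fun c hc => abs_le_of_slot_eq ?_ ?_⟩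
        · simp [hps, cubeSlot, hyk, hg, hya, hyb, hab]
        · have := hx c hc
          simp only [hpl, cubeLocal, hyk, hya, hyb, hyt, hH, hab, not_false_eq_true,
            and_true, if_true]
          rw [abs_le]
          by_cases hca : c = L.fstCoord z
          · subst hca
            simp only [if_neg hab, if_true]
            omega
          · simp only [if_neg hca]
            by_cases hcb : c = L.sndCoord z
            · subst hcb
              simp only [if_true]
              split_ifs at hsw ⊢ <;> omega
            · simp only [if_neg hcb]
              omega
  -- With two equal coordinates, kind `0` is no quadrant but a hypercube in the last slot.
  · have hcoord : L.fstCoord 0 = L.sndCoord 0 := by simp [fstCoord, sndCoord, digitAt]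
    by_cases hk : L.kind z = 2
    · obtain ⟨y, hy, -, -, -, -, -, hyk, -⟩ := exists_cube hv 0 (k := 4) (by omega) hY
      refine ⟨y, hy, fun c hc => abs_le_of_slot_eq ?_ ?_⟩
      · simp [pointSlot, hact, hk, cubeSlot, hyk]
      · have := hx c hc
        simp only [pointLocal, hact, hk, cubeLocal, hyk, OfNat.ofNat_ne_zero, OfNat.ofNat_ne_one,
          false_and, if_false, show ¬ (4 = 2) by omega, show ¬ (4 = 3) by omega]
        rw [abs_le]
        omega
    · obtain ⟨y, hy, -, hya, hyb, -, -, hyk, -⟩ := exists_cube hv 0 (k := 0) (by omega) hY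
      have hab : L.fstCoord y = L.sndCoord y := by rw [hya, hyb, hcoord]
      refine ⟨y, hy, fun c hc => abs_le_of_slot_eq ?_ ?_⟩
      · simp [pointSlot, hact, hk, cubeSlot, hyk, hab]
      · have := hx c hc
        simp only [pointLocal, hact, cubeLocal, hyk, hab, not_true_eq_false, and_false,
          if_false, show ¬ (0 = 2) by omega, show ¬ (0 = 3) by omega]
        rw [abs_le]
        split_ifs <;> omega

end Layout

/-! ### From a translation that covers all points to a clique -/

namespace Layout

variable {L : Layout} {n : ℕ} {G : SimpleGraph (Fin n)}

/-- The points of every gadget are available. -/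
theorem exists_point (hv : L.Valid n) {a b i j k : ℕ} (ha : a < L.A) (hb : b < L.A)
    (hi : i < L.A) (hj : j < L.A) (hk : k < L.A) {d₁ d₂ : ℕ → ℕ} (h₁ : ∀ r, d₁ r < L.A)
    (h₂ : ∀ r, d₂ r < L.A) (hsame : a = b → ∀ r < L.ℓ, d₁ r = d₂ r)
    (hzero : a ≠ b → ∀ r < L.ℓ₁, r ≠ i → r ≠ j → d₁ r = 0) :
    ∃ z < L.A ^ (7 + (2 * L.ℓ - L.ℓ₁)), L.fstCoord z = a ∧ L.sndCoord z = b ∧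
      L.fstPlace z = i ∧ L.sndPlace z = j ∧ L.kind z = k ∧
      (∀ r < L.ℓ, L.fstDigit z r = d₁ r) ∧ (∀ r < L.ℓ, L.sndDigit z r = d₂ r) := by
  have hle := hv.ℓ₁_le
  -- Five header digits, the `ℓ` digits of the second shift, the upper `ℓ - ℓ₁` digits of the first,
  -- and two digits of the first shift at places `i` and `j`, used if these are below `ℓ₁`.
  set e : ℕ → ℕ := fun r => if r = 0 then a else if r = 1 then b else if r = 2 then i
    else if r = 3 then j else if r = 4 then k else if r < 5 + L.ℓ then d₂ (r - 5)
    else if r < 5 + (2 * L.ℓ - L.ℓ₁) then d₁ (L.ℓ₁ + (r - (5 + L.ℓ)))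
    else if r = 5 + (2 * L.ℓ - L.ℓ₁) then d₁ i else d₁ j with hedef
  have he : ∀ r < 7 + (2 * L.ℓ - L.ℓ₁), e r < L.A := by
    intro r _
    simp only [hedef]
    split_ifs
    all_goals first | assumption | exact h₁ _ | exact h₂ _
  have hdig : ∀ r < 7 + (2 * L.ℓ - L.ℓ₁), digitAt L.A r (ofDigitFn L.A _ e) = e r :=
    fun r hr => digitAt_ofDigitFn he hr
  have hsnd : ∀ r < L.ℓ, L.sndDigit (ofDigitFn L.A (7 + (2 * L.ℓ - L.ℓ₁)) e) r = d₂ r := by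
    intro r hr
    rw [sndDigit, hdig _ (by omega)]
    simp only [hedef]
    iterate 5 rw [if_neg (by omega)]
    rw [if_pos (by omega)]
    congr 1
    omega
  have hfa : L.fstCoord (ofDigitFn L.A (7 + (2 * L.ℓ - L.ℓ₁)) e) = a := hdig 0 (by omega)
  have hfb : L.sndCoord (ofDigitFn L.A (7 + (2 * L.ℓ - L.ℓ₁)) e) = b := hdig 1 (by omega)
  have hfi : L.fstPlace (ofDigitFn L.A (7 + (2 * L.ℓ - L.ℓ₁)) e) = i := hdig 2 (by omega)
  have hfj : L.sndPlace (ofDigitFn L.A (7 + (2 * L.ℓ - L.ℓ₁)) e) = j := hdig 3 (by omega)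
  refine ⟨ofDigitFn L.A _ e, ofDigitFn_lt he, hfa, hfb, hfi, hfj, hdig 4 (by omega),
    fun r hr => ?_, hsnd⟩
  rw [fstDigit, hfa, hfb, hfi, hfj]
  split_ifs with hab hr₁ hri hrj
  · rw [hsnd r hr, hsame hab r hr]
  · rw [hdig _ (by omega)]
    simp only [hedef]
    iterate 7 rw [if_neg (by omega)]
    rw [if_pos trivial, hri]
  · rw [hdig _ (by omega)]
    simp only [hedef]
    iterate 8 rw [if_neg (by omega)]
    rw [hrj]
  · exact (hzero hab r hr₁ hri hrj).symm
  · rw [hdig _ (by omega)]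
    simp only [hedef]
    iterate 6 rw [if_neg (by omega)]
    rw [if_pos (by omega)]
    congr 1
    omega

theorem gadget_lt (hv : L.Valid n) (z : ℕ) : L.gadget z < L.A ^ 4 :=
  Nat.mod_lt _ (pow_pos hv.A_pos _)

theorem cubeSlot_le (hv : L.Valid n) (z : ℕ) : L.cubeSlot z ≤ L.A ^ 4 + 1 := by
  have := gadget_lt hv z
  unfold cubeSlot
  split_ifs <;> omega

theorem abs_pointLocal_le (hv : L.Valid n) (z c : ℕ) :
    |L.pointLocal G z c| ≤ 30 * L.range := by
  have := fstShift_lt hv z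
  have := sndShift_lt hv z
  rw [abs_le]
  unfold pointLocal
  split_ifs <;> omega

theorem abs_cubeLocal_le (hv : L.Valid n) (z c : ℕ) :
    |L.cubeLocal n z c| ≤ 20 * L.range := by
  have := step_lt hv z
  have := lowRange_le hv
  have := lowRange_pos hv
  rw [abs_le]
  unfold cubeLocal
  split_ifs <;> push_cast <;> omega

theorem cubeLocal_of_last_slot (hv : L.Valid n) {z : ℕ} (h : L.cubeSlot z = L.A ^ 4 + 1) (c : ℕ) :
    L.cubeLocal n z c = 16 * L.range - 1 := by
  have := gadget_lt hv z
  unfold cubeSlot at h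
  split_ifs at h with h₁ h₂
  · omega
  · unfold cubeLocal
    rw [if_neg, if_neg, if_neg, if_neg] <;> tauto

theorem gadget_of_cubeSlot (hv : L.Valid n) {y z : ℕ} (h : 1 + L.gadget z = L.cubeSlot y) :
    L.gadget y = L.gadget z ∧ (((L.kind y = 0 ∨ L.kind y = 1) ∧ ¬ L.fstCoord y = L.sndCoord y) ∨
      L.kind y = 2 ∨ L.kind y = 3) := by
  have := gadget_lt hv z
  unfold cubeSlot at h
  split_ifs at h with h₁ h₂
  · exact ⟨by omega, h₁⟩
  · omega
  · omega

variable {W : ℕ → ℝ}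

/-- Every translated point is covered by a hypercube in its own slot. -/
theorem covered_locally (hv : L.Valid n)
    (hW : ∀ z < L.A ^ (7 + (2 * L.ℓ - L.ℓ₁)), ∃ (y : ℕ) (ε : ℝ), |ε| ≤ 1 / 4 ∧ ∀ c < L.d,
      |W c + L.pointCoord G z c - L.cubeCoord n y c + ε| ≤ 16 * L.range)
    {z : ℕ} (hz : z < L.A ^ (7 + (2 * L.ℓ - L.ℓ₁))) :
    ∃ (y : ℕ) (ε : ℝ), |ε| ≤ 1 / 4 ∧ L.pointSlot G z = L.cubeSlot y ∧ ∀ c < L.d,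
      |W c + L.pointLocal G z c - L.cubeLocal n y c + ε| ≤ 16 * L.range := by
  have hA := hv.five_le
  have hX : (1 : ℝ) ≤ L.range := by exact_mod_cast (lowRange_pos hv).trans_le (lowRange_le hv)
  have hpl : ∀ z, |(L.pointLocal G z 0 : ℝ)| ≤ 30 * L.range := fun z => by
    exact_mod_cast abs_pointLocal_le hv z 0
  have hcl : ∀ z, |(L.cubeLocal n z 0 : ℝ)| ≤ 20 * L.range := fun z => by
    exact_mod_cast abs_cubeLocal_le hv z 0
  have anchor : ∀ k, k = 2 ∨ k = 3 → ∃ z < L.A ^ (7 + (2 * L.ℓ - L.ℓ₁)), L.kind z = k := by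
    intro k hk
    obtain ⟨z, hz, -, -, -, -, hk, -⟩ := exists_point hv (a := 0) (b := 0) (i := 0) (j := 0)
      (k := k) (by omega) (by omega) (by omega) (by omega) (by omega) (d₁ := fun _ => 0)
      (d₂ := fun _ => 0) (fun _ => by omega) (fun _ => by omega) (fun _ _ _ => rfl)
      (fun _ _ _ _ _ => rfl)
    exact ⟨z, hz, hk⟩
  have hpos := hv.d_pos
  -- A point in the last slot has no slot to its right; `37` exceeds the local extent `20` plus the
  -- half-width `16`, with room for `ε`.
  have upper : W 0 ≤ 37 * L.range := by
    obtain ⟨z, hz, hk⟩ := anchor 3 (.inr rfl)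
    obtain ⟨y, ε, hε, hy⟩ := hW z hz
    have h := hy 0 hpos
    have hact : ¬ L.Active G z := fun h => by
      have := h.1
      omega
    have hs : ((L.cubeSlot y : ℕ) : ℝ) ≤ L.A ^ 4 + 1 := by exact_mod_cast cubeSlot_le hv y
    have hs' : (256 * L.range : ℝ) * L.cubeSlot y ≤ 256 * L.range * (L.A ^ 4 + 1) :=
      mul_le_mul_of_nonneg_left hs (by positivity)
    have hcl := abs_le.1 (hcl y)
    have hε := abs_le.1 hε
    simp only [pointCoord, cubeCoord, pointSlot, pointLocal, hact, hk, if_true, if_false,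
      OfNat.ofNat_ne_one, show ¬ (3 = 2) by omega] at h
    push_cast at h
    have h := abs_le.1 h
    linarith [h.2]
  have lower : -(37 * L.range) ≤ W 0 := by
    obtain ⟨z, hz, hk⟩ := anchor 2 (.inl rfl)
    obtain ⟨y, ε, hε, hy⟩ := hW z hz
    have h := hy 0 hpos
    have hact : ¬ L.Active G z := fun h => by
      have := h.1
      omega
    have hs' : (0 : ℝ) ≤ (256 * L.range : ℝ) * L.cubeSlot y := by positivity
    have hcl := abs_le.1 (hcl y)
    have hε := abs_le.1 hε
    simp only [pointCoord, cubeCoord, pointSlot, pointLocal, hact, hk, if_true, if_false,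
      OfNat.ofNat_ne_one] at h
    push_cast at h
    have h := abs_le.1 h
    linarith [h.1]
  obtain ⟨y, ε, hε, hy⟩ := hW z hz
  -- A change of slot costs `256 * range`, but `37 + 30 + 20 + 16` multiples of `range` and `1 / 4`
  -- are all that is available.
  have hslot : L.pointSlot G z = L.cubeSlot y := by
    have h := hy 0 hpos
    have hcl := abs_le.1 (hcl y)
    have hpl := abs_le.1 (hpl z)
    have hε := abs_le.1 hε
    simp only [pointCoord, cubeCoord, if_true] at h
    push_cast at h
    have h := abs_le.1 h
    rcases lt_trichotomy (L.pointSlot G z) (L.cubeSlot y) with hlt | heq | hlt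
    · have hlt' : (L.pointSlot G z : ℝ) + 1 ≤ L.cubeSlot y := by exact_mod_cast hlt
      have := mul_le_mul_of_nonneg_left hlt' (by positivity : (0 : ℝ) ≤ 256 * L.range)
      linarith [h.1]
    · exact heq
    · have hlt' : (L.cubeSlot y : ℝ) + 1 ≤ L.pointSlot G z := by exact_mod_cast hlt
      have := mul_le_mul_of_nonneg_left hlt' (by positivity : (0 : ℝ) ≤ 256 * L.range)
      linarith [h.2]
  refine ⟨y, ε, hε, hslot, fun c hc => ?_⟩
  convert hy c hc using 2
  simp only [pointCoord, cubeCoord, hslot]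
  push_cast
  ring

/-- If all translated points are covered, then the translation vector encodes a clique. -/
theorem exists_clique_of_covered (hv : L.Valid n)
    (hW : ∀ z < L.A ^ (7 + (2 * L.ℓ - L.ℓ₁)), ∃ (y : ℕ) (ε : ℝ), |ε| ≤ 1 / 4 ∧ ∀ c < L.d,
      |W c + L.pointCoord G z c - L.cubeCoord n y c + ε| ≤ 16 * L.range) :
    ∃ x : ℕ → ℕ, ∀ a < L.d, ∀ b < L.d, ∀ i < L.ℓ, ∀ j < L.ℓ, ¬ (a = b ∧ i = j) →
      AdjNat G (digitAt L.A i (x a)) (digitAt L.A j (x b)) := by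
  have cov := fun z hz => covered_locally hv hW (z := z) hz
  have hA := hv.five_le
  have hdA := hv.d_le
  have hℓA := hv.ℓ_le
  -- The last slot contains copies of one hypercube only. Its points of kinds `3` and `1` touch its
  -- two ends, up to the margin and `ε`.
  have bounds : ∀ c < L.d, -(5 / 4) ≤ W c ∧ W c ≤ 4 * L.range - 11 / 4 := by
    intro c hc
    constructor
    · obtain ⟨z, hz, -, -, -, -, hk, -⟩ := exists_point hv (a := 0) (b := 0) (i := 0) (j := 0)
        (k := 3) (by omega) (by omega) (by omega) (by omega) (by omega) (d₁ := fun _ => 0)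
        (d₂ := fun _ => 0) (fun _ => by omega) (fun _ => by omega) (fun _ _ _ => rfl)
        (fun _ _ _ _ _ => rfl)
      obtain ⟨y, ε, hε, hs, hy⟩ := cov z hz
      have h := hy c hc
      have hact : ¬ L.Active G z := fun h => by
        have := h.1
        omega
      rw [cubeLocal_of_last_slot hv (hs.symm.trans (by simp [pointSlot, hact, hk]))] at h
      simp only [pointLocal, hact, hk, if_false, OfNat.ofNat_ne_one] at h
      push_cast at h
      have h := abs_le.1 h
      linarith [h.1, (abs_le.1 hε).2]
    · obtain ⟨z, hz, -, -, -, -, hk, -⟩ := exists_point hv (a := 0) (b := 0) (i := 0) (j := 0)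
        (k := 1) (by omega) (by omega) (by omega) (by omega) (by omega) (d₁ := fun _ => 0)
        (d₂ := fun _ => 0) (fun _ => by omega) (fun _ => by omega) (fun _ _ _ => rfl)
        (fun _ _ _ _ _ => rfl)
      obtain ⟨y, ε, hε, hs, hy⟩ := cov z hz
      have h := hy c hc
      have hact : ¬ L.Active G z := fun h => by
        have := h.1
        omega
      rw [cubeLocal_of_last_slot hv (hs.symm.trans (by simp [pointSlot, hact, hk]))] at h
      simp only [pointLocal, hact, hk, if_false, if_true] at h
      push_cast at h
      have h := abs_le.1 h
      linarith [h.2, (abs_le.1 hε).1]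
  -- Rounding `W c / 4` moves `W c` by at most `2`, and the bounds are tight enough for the result
  -- to lie in `[0, range)`.
  have hround : ∀ c, ∃ x : ℕ, c < L.d → x < L.range ∧ |W c - 4 * x| ≤ 2 := by
    intro c
    by_cases hc : c < L.d
    swap
    · exact ⟨0, fun h => absurd h hc⟩
    obtain ⟨h₁, h₂⟩ := bounds c hc
    have hr := abs_le.1 (abs_sub_round (W c / 4))
    have h0 : 0 ≤ round (W c / 4) := by
      have : (-1 : ℝ) < round (W c / 4) := by linarith [hr.2]
      have : (-1 : ℤ) < round (W c / 4) := by exact_mod_cast this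
      omega
    obtain ⟨x, hx⟩ := Int.eq_ofNat_of_zero_le h0
    rw [hx, Int.cast_natCast] at hr
    refine ⟨x, fun _ => ⟨?_, ?_⟩⟩
    · have : (x : ℝ) < L.range := by linarith [hr.1]
      exact_mod_cast this
    · rw [abs_le]
      constructor <;> linarith [hr.1, hr.2]
  choose x hx using hround
  have hxd : ∀ c < L.d, ofDigitFn L.A L.ℓ (digitAt L.A · (x c)) = x c := fun c hc =>
    (ofDigitFn_digitAt _ _ _).trans (Nat.mod_eq_of_lt (hx c hc).1)
  have hdl : ∀ r y, digitAt L.A r y < L.A := fun r y => digitAt_lt hv.A_pos r y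
  -- A point shifted by `x a` itself would lie in the gap: both half-spaces end at distance `3` from
  -- it, more than the rounding error `2` plus `1 / 4`.
  have same : ∀ a < L.d, ∀ i < L.ℓ, ∀ j < L.ℓ, i ≠ j →
      AdjNat G (digitAt L.A i (x a)) (digitAt L.A j (x a)) := by
    intro a ha i hi j hj hij
    by_contra hnadj
    obtain ⟨z, hz, hza, hzb, hzi, hzj, hk, h₁, h₂⟩ := exists_point hv (a := a) (b := a) (i := i)
      (j := j) (k := 0) (by omega) (by omega) (by omega) (by omega) (by omega)
      (d₁ := (digitAt L.A · (x a))) (d₂ := (digitAt L.A · (x a))) (fun _ => hdl _ _)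
      (fun _ => hdl _ _) (fun _ _ _ => rfl) (fun h => absurd rfl h)
    have hact : L.Active G z := by
      refine ⟨hk, hza ▸ ha, hzb ▸ ha, i, hi, hzi, j, hj, hzj, fun h => hij h.2, ?_⟩
      rwa [h₁ i hi, h₂ j hj]
    have hsh : L.sndShift z = x a := (ofDigitFn_congr h₂).trans (hxd a ha)
    obtain ⟨y, ε, hε, hs, hy⟩ := cov z hz
    obtain ⟨hg, hkind⟩ := gadget_of_cubeSlot hv (z := z)
      ((if_pos hact : L.pointSlot G z = _).symm.trans hs)
    have hya : L.fstCoord y = a := (digitAt_eq_of_gadget_eq hg (by omega)).trans hza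
    have hyb : L.sndCoord y = a := (digitAt_eq_of_gadget_eq hg (by omega)).trans hzb
    have h := hy a ha
    have hxa := abs_le.1 (hx a ha).2
    have hε := abs_le.1 hε
    rw [pointLocal, if_pos hact, if_pos hzb.symm, hsh] at h
    rcases hkind with hkind | hkind | hkind
    · exact hkind.2 (hya.trans hyb.symm)
    · simp only [cubeLocal, hkind, hya, OfNat.ofNat_ne_zero, OfNat.ofNat_ne_one, false_and,
        if_false, if_true] at h
      push_cast at h
      have h := abs_le.1 h
      linarith [h.2]
    · simp only [cubeLocal, hkind, hya, hyb, OfNat.ofNat_ne_zero, OfNat.ofNat_ne_one, false_and,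
        if_false, if_true, show ¬ (3 = 2) by omega] at h
      push_cast at h
      have h := abs_le.1 h
      linarith [h.1]
  have hlt : ∀ a < L.d, ∀ i < L.ℓ, digitAt L.A i (x a) < n := fun a ha i hi =>
    lt_of_pairwise_adjNat hv.two_le_ℓ (same a ha) hi
  refine ⟨x, fun a ha b hb i hi j hj hne => ?_⟩
  rcases eq_or_ne a b with rfl | hab
  · exact same a ha i hi j hj fun h => hne ⟨rfl, h⟩
  by_contra hnadj
  have hnA := hv.two_mul_le
  -- the part of the digits of `x a` that is represented by the hypercubes
  set τ : ℕ → ℕ := fun r => if r < L.ℓ₁ ∧ r ≠ i ∧ r ≠ j then digitAt L.A r (x a) else 0 with hτ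
  have hτn : ∀ r, τ r < n := by
    intro r
    have := hlt a ha i hi
    simp only [hτ]
    split_ifs with h
    exacts [hlt a ha r (h.1.trans_le hv.ℓ₁_le), by omega]
  have hτA : ∀ r, τ r < L.A := fun r => by
    have := hτn r
    omega
  -- The point whose shifts are `x a - t` and `x b + t`, formed digitwise with the digits `τ` of
  -- `t`; `2 * n ≤ A` keeps the sums below the base.
  obtain ⟨z, hz, hza, hzb, hzi, hzj, hk, h₁, h₂⟩ := exists_point hv (a := a) (b := b) (i := i)
    (j := j) (k := 0) (by omega) (by omega) (by omega) (by omega) (by omega)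
    (d₁ := fun r => digitAt L.A r (x a) - τ r)
    (d₂ := fun r => if r < L.ℓ then digitAt L.A r (x b) + τ r else 0)
    (fun r => (Nat.sub_le _ _).trans_lt (hdl _ _))
    (fun r => by
      split_ifs with hr
      · have := hlt b hb r hr
        have := hτn r
        omega
      · omega)
    (fun h => absurd h hab)
    (fun _ r hr hri hrj => by simp [hτ, hr, hri, hrj])
  have hτi : τ i = 0 := by simp [hτ]
  have hτj : τ j = 0 := by simp [hτ]
  have hact : L.Active G z := by
    refine ⟨hk, hza ▸ ha, hzb ▸ hb, i, hi, hzi, j, hj, hzj, fun h => ?_, ?_⟩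
    · rw [hza, hzb] at h
      exact hab h.1
    · rw [h₁ i hi, h₂ j hj, if_pos hj, hτi, hτj]
      exact hnadj
  set t := ofDigitFn L.A L.ℓ₁ τ with ht
  have htY : t < L.lowRange := ofDigitFn_lt fun r _ => hτA r
  have htℓ : ofDigitFn L.A L.ℓ τ = t := by
    rw [ht]
    unfold ofDigitFn
    refine (Finset.sum_subset (Finset.range_mono hv.ℓ₁_le) fun r _ hr => ?_).symm
    have hr' : ¬ r < L.ℓ₁ := by simpa using hr
    simp [hτ, hr']
  have hfst : L.fstShift z + t = x a := by
    rw [fstShift, ← htℓ, ← ofDigitFn_add, ← hxd a ha]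
    refine ofDigitFn_congr fun r hr => ?_
    rw [h₁ r hr]
    refine Nat.sub_add_cancel ?_
    simp only [hτ]
    split_ifs <;> omega
  have hsnd : L.sndShift z = x b + t := by
    rw [sndShift, ← htℓ, ← hxd b hb, ← ofDigitFn_add]
    refine ofDigitFn_congr fun r hr => ?_
    rw [h₂ r hr, if_pos hr]
  obtain ⟨y, ε, hε, hs, hy⟩ := cov z hz
  obtain ⟨hg, hkind⟩ := gadget_of_cubeSlot hv (z := z)
    ((if_pos hact : L.pointSlot G z = _).symm.trans hs)
  have hya : L.fstCoord y = a := (digitAt_eq_of_gadget_eq hg (by omega)).trans hza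
  have hyb : L.sndCoord y = b := (digitAt_eq_of_gadget_eq hg (by omega)).trans hzb
  have hyi : L.fstPlace y = i := (digitAt_eq_of_gadget_eq hg (by omega)).trans hzi
  have hyj : L.sndPlace y = j := (digitAt_eq_of_gadget_eq hg (by omega)).trans hzj
  have hhole : L.Hole n y t := by
    intro r hr
    rw [ht, digitAt_ofDigitFn (fun r _ => hτA r) hr, hyi, hyj]
    exact ⟨hτn r, by rintro (rfl | rfl) <;> assumption⟩
  have hxa := abs_le.1 (hx a ha).2
  have hxb := abs_le.1 (hx b hb).2
  have hε := abs_le.1 hε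
  have hfst' : (x a : ℝ) = L.fstShift z + t := by exact_mod_cast hfst.symm
  have hsnd' : (L.sndShift z : ℝ) = x b + t := by exact_mod_cast hsnd
  have hya' := hy a ha
  have hyb' := hy b hb
  rw [pointLocal, if_pos hact, hzb, hza, if_neg hab, if_pos rfl] at hya'
  rw [pointLocal, if_pos hact, hzb, if_pos rfl] at hyb'
  -- The offsets are `(t, -t)` up to rounding. A lower quadrant would need parameter at least `t`,
  -- an upper one at most `t`; the second coordinate then rules out both, the lower one at `t`
  -- because of the hole.
  rcases hkind with ⟨hkind | hkind, -⟩ | hkind | hkind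
  · simp only [cubeLocal, hkind, hya, hyb, hab, not_false_eq_true, and_true, if_true] at hya'
    simp only [cubeLocal, hkind, hya, hyb, hab, hab.symm, not_false_eq_true, and_true, if_true,
      if_false] at hyb'
    push_cast at hya' hyb'
    have ua := (abs_le.1 hya').2
    have ub := (abs_le.1 hyb').2
    have hle : t ≤ L.step y := by
      have : (t : ℝ) < L.step y + 1 := by linarith
      have : t < L.step y + 1 := by exact_mod_cast this
      omega
    rcases hle.eq_or_lt with heq | hlt
    · rw [← heq, if_pos hhole] at ub
      linarith
    · have hlt' : (t : ℝ) + 1 ≤ L.step y := by exact_mod_cast hlt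
      split_ifs at ub <;> linarith
  · simp only [cubeLocal, hkind, hya, hyb, hab, not_false_eq_true, and_true, if_true, if_false,
      one_ne_zero] at hya'
    simp only [cubeLocal, hkind, hya, hyb, hab, hab.symm, not_false_eq_true, and_true, if_true,
      if_false, one_ne_zero] at hyb'
    push_cast at hya' hyb'
    have ua := (abs_le.1 hya').1
    have ub := (abs_le.1 hyb').1
    have hle : L.step y ≤ t := by
      have : (L.step y : ℝ) < t + 1 := by linarith
      have : L.step y < t + 1 := by exact_mod_cast this
      omega
    have hle' : (L.step y : ℝ) ≤ t := by exact_mod_cast hle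
    linarith
  · simp only [cubeLocal, hkind, hya, OfNat.ofNat_ne_zero, OfNat.ofNat_ne_one, false_and,
      if_false, if_true] at hya'
    push_cast at hya'
    have h := (abs_le.1 hya').2
    have : (0 : ℝ) ≤ t := Nat.cast_nonneg t
    linarith
  · simp only [cubeLocal, hkind, hya, hyb, hab, OfNat.ofNat_ne_zero, OfNat.ofNat_ne_one, false_and,
      if_false, if_true, show ¬ (3 = 2) by omega] at hya'
    push_cast at hya'
    have h := (abs_le.1 hya').1
    have : (t : ℝ) + 1 ≤ L.lowRange := by exact_mod_cast htY
    linarith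

end Layout

/-! ### The instance is computed by local code -/

/-- The parameters used for graphs with `n` vertices. -/
def cliqueLayout (d ℓ ℓ₁ K n : ℕ) : Layout :=
  ⟨d, ℓ, ℓ₁, K * n⟩

section LocalCode

variable {d ℓ ℓ₁ K : ℕ} {Z C : CliqueQuery → ℕ}

local notation "lay" => cliqueLayout d ℓ ℓ₁ K

theorem WordFn.base : WordFn fun x => (lay x.n).A :=
  (WordFn.const K).mul .vertices

theorem WordFn.digitAt (hZ : WordFn Z) (r : ℕ) : WordFn fun x => digitAt (lay x.n).A r (Z x) :=
  (hZ.div (WordFn.base.pow r)).mod WordFn.base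

theorem WordFn.range : WordFn fun x => (lay x.n).range :=
  WordFn.base.pow ℓ

theorem WordFn.lowRange : WordFn fun x => (lay x.n).lowRange :=
  WordFn.base.pow ℓ₁

theorem WordFn.gadget (hZ : WordFn Z) : WordFn fun x => (lay x.n).gadget (Z x) :=
  hZ.mod (WordFn.base.pow 4)

theorem WordFn.fstCoord (hZ : WordFn Z) : WordFn fun x => (lay x.n).fstCoord (Z x) :=
  hZ.digitAt 0

theorem WordFn.sndCoord (hZ : WordFn Z) : WordFn fun x => (lay x.n).sndCoord (Z x) :=
  hZ.digitAt 1

theorem WordFn.fstPlace (hZ : WordFn Z) : WordFn fun x => (lay x.n).fstPlace (Z x) :=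
  hZ.digitAt 2

theorem WordFn.sndPlace (hZ : WordFn Z) : WordFn fun x => (lay x.n).sndPlace (Z x) :=
  hZ.digitAt 3

theorem WordFn.kind (hZ : WordFn Z) : WordFn fun x => (lay x.n).kind (Z x) :=
  hZ.digitAt 4

theorem WordFn.sndDigit (hZ : WordFn Z) (r : ℕ) : WordFn fun x => (lay x.n).sndDigit (Z x) r :=
  hZ.digitAt (5 + r)

theorem WordFn.fstDigit (hZ : WordFn Z) (r : ℕ) : WordFn fun x => (lay x.n).fstDigit (Z x) r :=
  .ite (.eq hZ.fstCoord hZ.sndCoord) (hZ.sndDigit r) <|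
    .ite (.const (r < ℓ₁))
      (.ite (.eq (.const r) hZ.fstPlace) (hZ.digitAt (5 + (2 * ℓ - ℓ₁))) <|
        .ite (.eq (.const r) hZ.sndPlace) (hZ.digitAt (6 + (2 * ℓ - ℓ₁))) (.const 0))
      (hZ.digitAt (5 + ℓ + (r - ℓ₁)))

theorem WordFn.fstShift (hZ : WordFn Z) : WordFn fun x => (lay x.n).fstShift (Z x) :=
  .sum_range ℓ fun r _ => (hZ.fstDigit r).mul (WordFn.base.pow r)

theorem WordFn.sndShift (hZ : WordFn Z) : WordFn fun x => (lay x.n).sndShift (Z x) :=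
  .sum_range ℓ fun r _ => (hZ.sndDigit r).mul (WordFn.base.pow r)

theorem CondFn.active (hZ : WordFn Z) : CondFn fun x => (lay x.n).Active x.G (Z x) :=
  (CondFn.eq hZ.kind (.const 0)).and <| (CondFn.lt hZ.fstCoord (.const d)).and <|
    (CondFn.lt hZ.sndCoord (.const d)).and <| .exists_lt ℓ fun i _ =>
      (CondFn.eq hZ.fstPlace (.const i)).and <| .exists_lt ℓ fun j _ =>
        (CondFn.eq hZ.sndPlace (.const j)).and <|
          ((CondFn.eq hZ.fstCoord hZ.sndCoord).and (.const (i = j))).not.and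
            (CondFn.adjNat (hZ.fstDigit i) (hZ.sndDigit j)).not

theorem WordFn.pointSlot (hZ : WordFn Z) : WordFn fun x => (lay x.n).pointSlot x.G (Z x) :=
  .ite (.active hZ) ((WordFn.const 1).add hZ.gadget) <|
    .ite (.eq hZ.kind (.const 2)) (.const 0) ((WordFn.base.pow 4).add (.const 1))

theorem IntFn.pointLocal (hZ : WordFn Z) (hC : WordFn C) :
    IntFn fun x => (lay x.n).pointLocal x.G (Z x) (C x) :=
  .ite (.active hZ)
    (.ite (.eq hC hZ.sndCoord) ((IntFn.const 0).sub ((IntFn.const 4).mul hZ.sndShift.intCast)) <|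
      .ite (.eq hC hZ.fstCoord) ((IntFn.const 0).sub ((IntFn.const 4).mul hZ.fstShift.intCast))
        (.const 0)) <|
    .ite (.eq hZ.kind (.const 1)) (((IntFn.const 28).mul WordFn.range.intCast).add (.const 2))
      (.const 0)

theorem IntFn.pointCoord (hZ : WordFn Z) (hC : WordFn C) :
    IntFn fun x => (lay x.n).pointCoord x.G (Z x) (C x) :=
  .add (WordFn.ite (.eq hC (.const 0))
    (((WordFn.const 256).mul WordFn.range).mul hZ.pointSlot) (.const 0)).intCast
    (.pointLocal hZ hC)

theorem WordFn.step (hZ : WordFn Z) : WordFn fun x => (lay x.n).step (Z x) :=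
  (hZ.div (WordFn.base.pow 5)).mod WordFn.lowRange

theorem CondFn.hole (hZ : WordFn Z) (hC : WordFn C) :
    CondFn fun x => (lay x.n).Hole x.n (Z x) (C x) :=
  .forall_lt ℓ₁ fun r _ => (CondFn.lt (hC.digitAt r) .vertices).and <|
    ((CondFn.eq (.const r) hZ.fstPlace).or (.eq (.const r) hZ.sndPlace)).imp
      (.eq (hC.digitAt r) (.const 0))

theorem WordFn.cubeSlot (hZ : WordFn Z) : WordFn fun x => (lay x.n).cubeSlot (Z x) :=
  .ite ((((CondFn.eq hZ.kind (.const 0)).or (.eq hZ.kind (.const 1))).and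
      (CondFn.eq hZ.fstCoord hZ.sndCoord).not).or
      ((CondFn.eq hZ.kind (.const 2)).or (.eq hZ.kind (.const 3))))
    ((WordFn.const 1).add hZ.gadget) <|
    .ite (.eq hZ.kind (.const 4)) (.const 0) ((WordFn.base.pow 4).add (.const 1))

theorem IntFn.cubeLocal (hZ : WordFn Z) (hC : WordFn C) :
    IntFn fun x => (lay x.n).cubeLocal x.n (Z x) (C x) := by
  have hne : CondFn fun x => ¬ (lay x.n).fstCoord (Z x) = (lay x.n).sndCoord (Z x) :=
    (CondFn.eq hZ.fstCoord hZ.sndCoord).not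
  have hX : IntFn fun x => 16 * ((lay x.n).range : ℤ) := (IntFn.const 16).mul WordFn.range.intCast
  have ht : IntFn fun x => 4 * ((lay x.n).step (Z x) : ℤ) := (IntFn.const 4).mul hZ.step.intCast
  have hy : WordFn fun x => if (lay x.n).fstCoord (Z x) = (lay x.n).sndCoord (Z x) then 1
      else (lay x.n).lowRange := .ite (.eq hZ.fstCoord hZ.sndCoord) (.const 1) .lowRange
  refine .ite ((CondFn.eq hZ.kind (.const 0)).and hne)
    (.ite (.eq hC hZ.fstCoord) ((ht.add (.const 1)).sub hX) <|
      .ite (.eq hC hZ.sndCoord) ((((IntFn.const 1).sub ht).sub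
        (.ite (.hole hZ hZ.step) (.const 4) (.const 0))).sub hX) (.const 0)) <|
    .ite ((CondFn.eq hZ.kind (.const 1)).and hne)
    (.ite (.eq hC hZ.fstCoord) ((ht.sub (.const 1)).add hX) <|
      .ite (.eq hC hZ.sndCoord) (((IntFn.const 3).sub ht).add hX) (.const 0)) <|
    .ite (.eq hZ.kind (.const 2)) (.ite (.eq hC hZ.fstCoord) ((IntFn.const (-3)).sub hX) (.const 0))
    <| .ite (.eq hZ.kind (.const 3))
      (.ite (.eq hC hZ.fstCoord) ((((IntFn.const 4).mul ?_).sub (.const 1)).add hX) (.const 0))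
      (hX.sub (.const 1))
  exact hy.intCast

theorem IntFn.cubeCoord (hZ : WordFn Z) (hC : WordFn C) :
    IntFn fun x => (lay x.n).cubeCoord x.n (Z x) (C x) :=
  .add (WordFn.ite (.eq hC (.const 0))
    (((WordFn.const 256).mul WordFn.range).mul hZ.cubeSlot) (.const 0)).intCast
    (.cubeLocal hZ hC)

end LocalCode

/-! ### Running a program on a locally computed instance -/

/-- A combinatorial program can be run on an instance that is computed by local code from a graph,
and its result can be translated by one expression. -/
theorem exists_redirected_program {𝒞 : Set Program} {p : Program} (hp : Combinatorial 𝒞 p)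
    (inst : ∀ n, SimpleGraph (Fin n) → Input)
    (hw : WordFn fun x => (inst x.n x.G).words x.i)
    (hr : RealFn fun x => (inst x.n x.G).reals x.i) (B : ℕ → ℕ) (hB : WordFn fun x => B x.n)
    (out : Expr .word) (hout : ∀ (inp : Input) (s : Memory) (B : ℕ), 1 ≤ B →
      (∀ a, s.words a ≤ B) → out.Fits inp s 0 B) :
    ∃ q : Program, Combinatorial 𝒞 q ∧ ∃ c : ℕ, ∀ (n : ℕ) (G : SimpleGraph (Fin n)) (t : ℕ)
      (s : Memory), Exec (inst n G) (B n) p Memory.zero t s →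
        Exec (cliqueInput G) ((n + 2) ^ c) q Memory.zero (t + 1)
          ⟨Function.update s.words 0 (out.eval (cliqueInput G) s 0), s.reals⟩ := by
  obtain ⟨f, mf, ef, ff⟩ := hw
  obtain ⟨g, mg, eg, fg⟩ := hr
  obtain ⟨b, -, eb, fb⟩ := hB
  -- As `B` depends on `n` only, evaluating its code for the empty graph at address `0` already
  -- bounds it.
  obtain ⟨c₀, h₀⟩ := fb 0
  obtain ⟨c₁, h₁⟩ := ff.both fg c₀
  have hBn : ∀ n : ℕ, B n ≤ (n + 2) ^ c₀ := fun n => by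
    have h := Expr.eval_le_of_fits b (h₀ ⟨n, ⊥, 0⟩ Memory.zero (Nat.zero_le _))
    rw [eb] at h
    exact h
  refine ⟨_, .local_reduction f g out mf mg hp, max c₀ c₁, fun n G t s h => ?_⟩
  have hexec := exec_redirectProgram (inp := cliqueInput G) (inp' := inst n G)
    ((hBn n).trans (pow_le_pow_max_left n c₀ c₁)) (fun s j => ef ⟨n, G, j⟩ s)
    (fun s j => eg ⟨n, G, j⟩ s)
    (fun s j hj => (h₁ ⟨n, G, j⟩ s (hj.trans (hBn n))).1.mono (pow_le_pow_max_right _ _ _))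
    (fun s j hj => (h₁ ⟨n, G, j⟩ s (hj.trans (hBn n))).2.mono (pow_le_pow_max_right _ _ _)) h
  exact hexec.seq (Exec.wset (Nat.zero_le _) (hout _ _ _ (Nat.one_le_pow _ _ (by omega))
    fun a => hexec.words_le (fun _ => Nat.zero_le _) a))

/-! ### The decision problem and the optimization problem -/

section Hausdorff

variable {d n m : ℕ} {P : Fin n → Fin d → ℝ} {Q : Fin m → Fin d → ℝ}

theorem mem_translationSet {v : Fin d → ℝ} :
    v ∈ translationSet P Q ↔ ∀ i, ∃ j, ‖P i + v - Q j‖ ≤ 1 / 2 := by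
  simp only [translationSet, Set.mem_iInter, Set.mem_image, Set.mem_iUnion, unitHypercube,
    Set.mem_Icc, Pi.le_def]
  refine forall_congr' fun i => ?_
  constructor
  · rintro ⟨x, ⟨j, h₁, h₂⟩, rfl⟩
    refine ⟨j, (pi_norm_le_iff_of_nonneg (by norm_num)).2 fun c => ?_⟩
    have := h₁ c
    have := h₂ c
    simp only [Pi.sub_apply, Pi.add_apply, Real.norm_eq_abs, abs_le]
    constructor <;> linarith
  · rintro ⟨j, h⟩
    refine ⟨P i + v, ⟨j, fun c => ?_, fun c => ?_⟩, by simp⟩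
    all_goals
      have h := abs_le.1 ((pi_norm_le_iff_of_nonneg (by norm_num)).1 h c)
      simp only [Pi.sub_apply, Pi.add_apply] at h ⊢
      linarith [h.1, h.2]

/-- Finiteness and nonemptiness make the infima attained and the supremum a conjunction. -/
theorem directedHausdorff_le_iff [Nonempty (Fin n)] [Nonempty (Fin m)] {r : ℝ} :
    directedHausdorff P Q ≤ r ↔ ∀ i, ∃ j, ‖P i - Q j‖ ≤ r := by
  rw [directedHausdorff, ciSup_le_iff (Set.finite_range _).bddAbove]
  refine forall_congr' fun i => ⟨fun h => ?_, fun ⟨j, h⟩ => ?_⟩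
  · obtain ⟨j, hj⟩ := exists_eq_ciInf_of_finite (f := fun j => ‖P i - Q j‖)
    exact ⟨j, hj.le.trans h⟩
  · exact (ciInf_le (Set.finite_range _).bddBelow j).trans h

/-- Since the minimum is attained, `μ ≤ 1 / 2` provides an actual vector in the intersection. -/
theorem isLeast_le_half_iff (hn : 1 ≤ n) (hm : 1 ≤ m) {μ : ℝ}
    (h : IsLeast (Set.range fun v : Fin d → ℝ => directedHausdorff (fun i => P i + v) Q) μ) :
    μ ≤ 1 / 2 ↔ translationSet P Q ≠ ∅ := by
  have : Nonempty (Fin n) := ⟨⟨0, hn⟩⟩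
  have : Nonempty (Fin m) := ⟨⟨0, hm⟩⟩
  rw [← Set.nonempty_iff_ne_empty]
  constructor
  · intro hμ
    obtain ⟨v, hv⟩ := h.1
    exact ⟨v, mem_translationSet.2 (directedHausdorff_le_iff.1 (hv.le.trans hμ))⟩
  · rintro ⟨v, hv⟩
    exact (h.2 ⟨v, rfl⟩).trans (directedHausdorff_le_iff.2 (mem_translationSet.1 hv))

end Hausdorff

/-! ### The reduction -/

/-- Listing the clique in `d` rows of length `ℓ` gives `e`; conversely, irreflexivity of adjacency
makes the entries distinct. -/
theorem exists_isNClique_iff {n d ℓ : ℕ} (hℓ : 2 ≤ ℓ) {G : SimpleGraph (Fin n)} :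
    (∃ K : Finset (Fin n), G.IsNClique (d * ℓ) K) ↔
      ∃ e : ℕ → ℕ → ℕ, ∀ a < d, ∀ b < d, ∀ i < ℓ, ∀ j < ℓ, ¬ (a = b ∧ i = j) →
        AdjNat G (e a i) (e b j) := by
  constructor
  · rintro ⟨K, hK, hcard⟩
    set f : Fin d × Fin ℓ → Fin n := fun x => K.orderEmbOfFin hcard (finProdFinEquiv x) with hf
    have hfK : ∀ x, f x ∈ K := fun x => K.orderEmbOfFin_mem hcard _
    have hinj : Function.Injective f :=
      (K.orderEmbOfFin hcard).injective.comp finProdFinEquiv.injective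
    refine ⟨fun a i => if h : a < d ∧ i < ℓ then f (⟨a, h.1⟩, ⟨i, h.2⟩) else 0,
      fun a ha b hb i hi j hj hne => ?_⟩
    simp only [ha, hb, hi, hj, and_self, dif_pos]
    refine ⟨Fin.is_lt _, Fin.is_lt _, hK (hfK _) (hfK _) fun h => hne ?_⟩
    simpa using hinj h
  · rintro ⟨e, he⟩
    have hlt : ∀ x : Fin d × Fin ℓ, e x.1 x.2 < n := fun x =>
      lt_of_pairwise_adjNat hℓ (fun i hi j hj hij =>
        he x.1 x.1.2 x.1 x.1.2 i hi j hj fun h => hij h.2) x.2.2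
    have hadj : ∀ x y : Fin d × Fin ℓ, x ≠ y → G.Adj ⟨_, hlt x⟩ ⟨_, hlt y⟩ := fun x y hxy =>
      (he x.1 x.1.2 y.1 y.1.2 x.2 x.2.2 y.2 y.2.2 fun h =>
        hxy (Prod.ext (Fin.ext h.1) (Fin.ext h.2))).2.2
    have hinj : Function.Injective fun x : Fin d × Fin ℓ => (⟨_, hlt x⟩ : Fin n) := by
      intro x y hxy
      by_contra hne
      exact (hadj x y hne).ne hxy
    refine ⟨Finset.univ.map ⟨_, hinj⟩, ?_, by simp⟩
    rintro u hu w hw huw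
    obtain ⟨x, -, rfl⟩ := Finset.mem_map.1 hu
    obtain ⟨y, -, rfl⟩ := Finset.mem_map.1 hw
    exact hadj x y fun h => huw (congrArg _ h)

/-- Coordinate `c` of a point of the instance with `N` points. -/
noncomputable def Layout.scaledPoint (L : Layout) {n : ℕ} (G : SimpleGraph (Fin n))
    (N z c : ℕ) : ℝ :=
  ((L.pointCoord G z c : ℝ) + z / (4 * N : ℕ)) / (32 * L.range : ℕ)

/-- Coordinate `c` of the centre of a hypercube of the instance with `N` hypercubes. -/
noncomputable def Layout.scaledCube (L : Layout) (n N z c : ℕ) : ℝ :=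
  ((L.cubeCoord n z c : ℝ) + z / (4 * N : ℕ)) / (32 * L.range : ℕ)

/-- The perturbation lies in `[0, 1)`, so the integral part is determined, and then so is `z`. This
makes the points distinct even where numbers decode to the same position. -/
theorem injective_of_int_add_div {N : ℕ} {r : ℝ} (hr : 0 < r) {f : Fin N → ℝ} {k : Fin N → ℤ}
    (hf : ∀ z, f z = ((k z : ℝ) + (z : ℕ) / (4 * N : ℕ)) / r) : Function.Injective f := by
  intro y z hyz
  have hN : (0 : ℝ) < N := by exact_mod_cast (Nat.zero_le _).trans_lt y.2
  rw [hf, hf, div_left_inj' hr.ne'] at hyz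
  have hlt : ∀ z : Fin N, 0 ≤ ((z : ℕ) : ℝ) / (4 * N : ℕ) ∧ ((z : ℕ) : ℝ) / (4 * N : ℕ) < 1 := by
    intro z
    refine ⟨by positivity, ?_⟩
    have : ((z : ℕ) : ℝ) < N := by exact_mod_cast z.2
    rw [div_lt_one (by push_cast; positivity)]
    push_cast
    linarith
  have hk : k y = k z := by
    have h₁ : (k y : ℝ) < k z + 1 := by linarith [(hlt y).1, (hlt z).2]
    have h₂ : (k z : ℝ) < k y + 1 := by linarith [(hlt z).1, (hlt y).2]
    have h₁ : k y < k z + 1 := by exact_mod_cast h₁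
    have h₂ : k z < k y + 1 := by exact_mod_cast h₂
    omega
  rw [hk, add_right_inj, div_left_inj' (by push_cast; positivity)] at hyz
  exact Fin.ext (by exact_mod_cast hyz)

section Instance

variable {n d ℓ ℓ₁ K N M : ℕ} {G : SimpleGraph (Fin n)}

/-- Larger `N` and `M` do no harm, because every number decodes to a legitimate point or hypercube.
The perturbations differ by at most `1 / 4`, less than the margin `1` of a covering coming from a
clique. -/
theorem translationSet_ne_empty_iff (hv : (cliqueLayout d ℓ ℓ₁ K n).Valid n)
    (hN : (K * n) ^ (7 + (2 * ℓ - ℓ₁)) ≤ N) (hM : (K * n) ^ (5 + ℓ₁) ≤ M) :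
    translationSet
      (fun (z : Fin N) (c : Fin d) => (cliqueLayout d ℓ ℓ₁ K n).scaledPoint G N z c)
      (fun (z : Fin M) (c : Fin d) => (cliqueLayout d ℓ ℓ₁ K n).scaledCube n M z c) ≠ ∅ ↔
    ∃ S : Finset (Fin n), G.IsNClique (d * ℓ) S := by
  set L := cliqueLayout d ℓ ℓ₁ K n with hL
  have hX : (0 : ℝ) < (32 * L.range : ℕ) := by
    exact_mod_cast Nat.mul_pos (by norm_num) ((L.lowRange_pos hv).trans_le (L.lowRange_le hv))
  have hε : ∀ {N : ℕ} (z : Fin N), 0 ≤ ((z : ℕ) : ℝ) / (4 * N : ℕ) ∧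
      ((z : ℕ) : ℝ) / (4 * N : ℕ) ≤ 1 / 4 := by
    intro N z
    refine ⟨by positivity, ?_⟩
    have hz : ((z : ℕ) : ℝ) < N := by exact_mod_cast z.2
    have hN : (0 : ℝ) < N := (Nat.cast_nonneg _).trans_lt hz
    rw [div_le_iff₀ (by push_cast; positivity)]
    push_cast
    linarith
  -- Multiplication by `32 * range` turns the half-width `1 / 2` into `16 * range`.
  have key : ∀ (v : Fin d → ℝ) (z : Fin N) (y : Fin M),
      ‖(fun c : Fin d => L.scaledPoint G N z c) + v - (fun c : Fin d => L.scaledCube n M y c)‖ ≤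
        1 / 2 ↔ ∀ c : Fin d, |(32 * L.range : ℕ) * v c + L.pointCoord G z c - L.cubeCoord n y c +
          ((z : ℕ) / (4 * N : ℕ) - (y : ℕ) / (4 * M : ℕ))| ≤ 16 * L.range := by
    intro v z y
    rw [pi_norm_le_iff_of_nonneg (by norm_num)]
    refine forall_congr' fun c => ?_
    have e : (fun c : Fin d => L.scaledPoint G N z c) c + v c -
        (fun c : Fin d => L.scaledCube n M y c) c =
        ((32 * L.range : ℕ) * v c + L.pointCoord G z c - L.cubeCoord n y c +
          ((z : ℕ) / (4 * N : ℕ) - (y : ℕ) / (4 * M : ℕ))) / (32 * L.range : ℕ) := by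
      simp only [Layout.scaledPoint, Layout.scaledCube]
      rw [eq_div_iff hX.ne', sub_mul, add_mul, div_mul_cancel₀ _ hX.ne', div_mul_cancel₀ _ hX.ne']
      ring
    rw [Pi.sub_apply, Pi.add_apply, e, Real.norm_eq_abs, abs_div, abs_of_pos hX,
      div_le_iff₀ hX]
    push_cast
    constructor <;> intro h <;> linarith
  rw [← Set.nonempty_iff_ne_empty, exists_isNClique_iff (ℓ := ℓ) hv.two_le_ℓ]
  constructor
  · rintro ⟨v, hv'⟩
    rw [mem_translationSet] at hv'
    obtain ⟨x, hx⟩ := L.exists_clique_of_covered (G := G)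
      (W := fun c => if h : c < d then (32 * L.range : ℕ) * v ⟨c, h⟩ else 0) hv fun z hz => by
        obtain ⟨y, hy⟩ := hv' ⟨z, hz.trans_le hN⟩
        rw [key] at hy
        refine ⟨y, (z : ℕ) / (4 * N : ℕ) - (y : ℕ) / (4 * M : ℕ), ?_, fun c hc => ?_⟩
        swap
        · rw [dif_pos (show c < d from hc)]
          exact hy ⟨c, hc⟩
        · have h₁ := hε (⟨z, hz.trans_le hN⟩ : Fin N)
          have h₂ := hε y
          rw [abs_le]
          constructor <;> linarith [h₁.1, h₁.2, h₂.1, h₂.2]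
    exact ⟨_, hx⟩
  · rintro ⟨e, he⟩
    refine ⟨fun c => 4 * ofDigitFn L.A ℓ (e c) / (32 * L.range : ℕ), mem_translationSet.2
      fun z => ?_⟩
    obtain ⟨y, hy, h⟩ := L.exists_cube_of_clique hv he z
    refine ⟨⟨y, hy.trans_le hM⟩, (key _ _ _).2 fun c => ?_⟩
    rw [mul_div_cancel₀ _ hX.ne']
    have h := abs_le.1 (h c c.2)
    have l : (-(16 * L.range - 1) : ℝ) ≤ 4 * ofDigitFn L.A ℓ (e c) + L.pointCoord G z c -
        L.cubeCoord n y c := by exact_mod_cast h.1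
    have u : (4 * ofDigitFn L.A ℓ (e c) + L.pointCoord G z c -
        L.cubeCoord n y c : ℝ) ≤ 16 * L.range - 1 := by exact_mod_cast h.2
    have h₁ := hε z
    have h₂ := hε (⟨y, hy.trans_le hM⟩ : Fin M)
    simp only at h₂
    rw [abs_le]
    constructor <;> linarith [h₁.1, h₁.2, h₂.1, h₂.2]

end Instance

/-! ### The lower bounds -/

/-- The instance with `N` points and `M` hypercubes that is constructed from a graph. -/
noncomputable def cliqueInstance (d ℓ ℓ₁ K N M : ℕ) {n : ℕ} (G : SimpleGraph (Fin n)) : Input :=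
  pointsInput (d := d)
    (fun (z : Fin N) (c : Fin d) => (cliqueLayout d ℓ ℓ₁ K n).scaledPoint G N z c)
    (fun (z : Fin M) (c : Fin d) => (cliqueLayout d ℓ ℓ₁ K n).scaledCube n M z c)

section LocalCode

variable {d ℓ ℓ₁ K : ℕ} {N M : CliqueQuery → ℕ}

theorem WordFn.cliqueInstance (hN : WordFn N) (hM : WordFn M) :
    WordFn fun x => (cliqueInstance d ℓ ℓ₁ K (N x) (M x) x.G).words x.i :=
  .ite (.eq .index (.const 0)) hN (.ite (.eq .index (.const 1)) hM (.const 0))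

theorem RealFn.cliqueInstance (hd : 0 < d) (hN : WordFn N) (hM : WordFn M) :
    RealFn fun x => (cliqueInstance d ℓ ℓ₁ K (N x) (M x) x.G).reals x.i := by
  have e : ∀ x : CliqueQuery, (_root_.cliqueInstance d ℓ ℓ₁ K (N x) (M x) x.G).reals x.i =
      if x.i / d < N x then
        (cliqueLayout d ℓ ℓ₁ K x.n).scaledPoint x.G (N x) (x.i / d) (x.i % d)
      else if x.i / d - N x < M x then
        (cliqueLayout d ℓ ℓ₁ K x.n).scaledCube x.n (M x) (x.i / d - N x) (x.i % d)
      else 0 := by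
    intro x
    simp only [_root_.cliqueInstance, pointsInput, hd, and_true]
    split_ifs <;> rfl
  simp only [e]
  have hZ : WordFn fun x => x.i / d := .div .index (.const d)
  have hC : WordFn fun x => x.i % d := .mod .index (.const d)
  have hZ' : WordFn fun x => x.i / d - N x := hZ.sub hN
  have hX : RealFn fun x => ((32 * (cliqueLayout d ℓ ℓ₁ K x.n).range : ℕ) : ℝ) :=
    ((WordFn.const 32).mul .range).realCast
  have hzero : RealFn fun _ => (0 : ℝ) := by simpa [IntFn] using IntFn.const 0
  exact .ite (.lt hZ hN)
    (.op .div (.op .add (IntFn.pointCoord hZ hC)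
      (.op .div hZ.realCast ((WordFn.const 4).mul hN).realCast)) hX)
    (.ite (.lt hZ' hM)
      (.op .div (.op .add (IntFn.cubeCoord hZ' hC)
        (.op .div hZ'.realCast ((WordFn.const 4).mul hM).realCast)) hX) hzero)

end LocalCode

/-- The expression has value `1` if the first word of the memory is not `1`, and `0` otherwise. -/
def negatedAnswer : Expr .word :=
  .wite (.and (.wle (.wmem (.wconst 0)) (.wconst 1)) (.wle (.wconst 1) (.wmem (.wconst 0))))
    (.wconst 0) (.wconst 1)

theorem negatedAnswer_eval (inp : Input) (s : Memory) :
    (negatedAnswer.eval inp s 0 : ℕ) = 1 ↔ s.words 0 ≠ 1 := by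
  simp only [negatedAnswer, Expr.eval, Bool.cond_eq_ite, Bool.and_eq_true]
  split_ifs with h
  · simp [le_antisymm (of_decide_eq_true h.1) (of_decide_eq_true h.2)]
  · exact iff_of_true rfl fun h' => h ⟨decide_eq_true h'.le, decide_eq_true h'.ge⟩

theorem negatedAnswer_fits (inp : Input) (s : Memory) (B : ℕ) (hB : 1 ≤ B)
    (hs : ∀ a, s.words a ≤ B) : negatedAnswer.Fits inp s 0 B := by
  simp [negatedAnswer, Expr.Fits, hB, hs]

/-- The expression has value `1` if the first real number of the memory is at most `1 / 2`, and `0`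
otherwise. -/
def thresholdAnswer : Expr .word :=
  .wite (.rle (.rmem (.wconst 0)) (.rconst (1 / 2))) (.wconst 1) (.wconst 0)

theorem thresholdAnswer_eval (inp : Input) (s : Memory) :
    (thresholdAnswer.eval inp s 0 : ℕ) = 1 ↔ s.reals 0 ≤ 1 / 2 := by
  simp only [thresholdAnswer, Expr.eval, Bool.cond_eq_ite]
  push_cast
  split_ifs with h
  · exact iff_of_true rfl (of_decide_eq_true h)
  · exact iff_of_false (by simp) fun h' => h (decide_eq_true h')

theorem thresholdAnswer_fits (inp : Input) (s : Memory) (B : ℕ) (hB : 1 ≤ B)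
    (_ : ∀ a, s.words a ≤ B) : thresholdAnswer.Fits inp s 0 B := by
  simp [thresholdAnswer, Expr.Fits, hB]

section LowerBound

variable {𝒞 : Set Program} {d ℓ ℓ₁ K D D' : ℕ} {T : ℕ → ℕ → ℝ} {C₀ : ℝ}

/-- A fast combinatorial program whose results on the constructed instances reveal whether there is
a clique contradicts the clique hypothesis. -/
theorem false_of_fast_program (hyp : CombinatorialCliqueHypothesis 𝒞) (hd : 1 ≤ d)
    (hk : 3 ≤ d * ℓ)
    (hT : ∀ n : ℕ, 1 ≤ n → 0 ≤ T ((K * n) ^ D) ((K * n) ^ D') ∧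
      T ((K * n) ^ D) ((K * n) ^ D') ≤ C₀ * (n : ℝ) ^ (((d * ℓ : ℕ) : ℝ) - 1))
    {p : Program} (hp : Combinatorial 𝒞 p) {out : Expr .word}
    (hout : ∀ (inp : Input) (s : Memory) (B : ℕ), 1 ≤ B → (∀ a, s.words a ≤ B) →
      out.Fits inp s 0 B) {C : ℝ} {c : ℕ}
    (h : ∀ n : ℕ, 1 ≤ n → ∀ G : SimpleGraph (Fin n), ∃ (t : ℕ) (s : Memory),
      Exec (cliqueInstance d ℓ ℓ₁ K ((K * n) ^ D) ((K * n) ^ D') G)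
        (((K * n) ^ D + (K * n) ^ D' + 2) ^ c) p Memory.zero t s ∧
      (t : ℝ) ≤ C * T ((K * n) ^ D) ((K * n) ^ D') ∧
      ∀ inp, (out.eval inp s 0 : ℕ) = 1 ↔ ∃ S : Finset (Fin n), G.IsNClique (d * ℓ) S) :
    False := by
  have hN : WordFn fun x => (K * x.n) ^ D := ((WordFn.const K).mul .vertices).pow D
  have hM : WordFn fun x => (K * x.n) ^ D' := ((WordFn.const K).mul .vertices).pow D'
  obtain ⟨q, hq, c', hrun⟩ := exists_redirected_program hp
    (fun n G => cliqueInstance d ℓ ℓ₁ K ((K * n) ^ D) ((K * n) ^ D') G)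
    (.cliqueInstance hN hM) (.cliqueInstance hd hN hM)
    (fun n => ((K * n) ^ D + (K * n) ^ D' + 2) ^ c)
    (((hN.add hM).add (.const 2)).pow c) out hout
  -- The constant `C` may be negative, hence `|C|`; the extra `1` pays for the final assignment.
  refine hyp (d * ℓ) hk 1 one_pos ⟨q, hq, |C| * C₀ + 1, c', fun n hn G => ?_⟩
  obtain ⟨t, s, hexec, ht, hs⟩ := h n hn G
  refine ⟨t + 1, _, hrun n G t s hexec, ?_, ?_⟩
  · obtain ⟨hT₀, hT₁⟩ := hT n hn
    have hk' : (3 : ℝ) ≤ (d * ℓ : ℕ) := by exact_mod_cast hk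
    have hone : 1 ≤ (n : ℝ) ^ (((d * ℓ : ℕ) : ℝ) - 1) :=
      Real.one_le_rpow (by exact_mod_cast hn) (by linarith)
    have h₁ : C * T ((K * n) ^ D) ((K * n) ^ D') ≤ |C| * T ((K * n) ^ D) ((K * n) ^ D') :=
      mul_le_mul_of_nonneg_right (le_abs_self C) hT₀
    have h₂ := mul_le_mul_of_nonneg_left hT₁ (abs_nonneg C)
    push_cast at *
    linarith
  · simpa using hs (cliqueInput G)

theorem valid_cliqueLayout {n : ℕ} (hn : 1 ≤ n) (hd : 1 ≤ d) (hdK : d ≤ K) (hℓK : ℓ ≤ K)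
    (hK : 5 ≤ K) (hℓ : 2 ≤ ℓ) (hℓ₁ : ℓ₁ ≤ ℓ) : (cliqueLayout d ℓ ℓ₁ K n).Valid n := by
  have h : K ≤ K * n := Nat.le_mul_of_pos_right K hn
  exact ⟨hd, hdK.trans h, hℓK.trans h, hℓ, hℓ₁, hK.trans h,
    Nat.mul_le_mul_right n (by omega)⟩

/-- Sizes that are exact powers of `K * n` can be computed by local code and made to satisfy `R`
exactly; the instance is padded up to them. -/
theorem noCombinatorialAlgorithm_of_le (hyp : CombinatorialCliqueHypothesis 𝒞) (hd : 1 ≤ d)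
    (hdK : d ≤ K) (hℓK : ℓ ≤ K) (hK : 5 ≤ K) (hℓ : 2 ≤ ℓ) (hℓ₁ : ℓ₁ ≤ ℓ) (hk : 3 ≤ d * ℓ)
    (hD : 7 + (2 * ℓ - ℓ₁) ≤ D) (hD' : 5 + ℓ₁ ≤ D') {R : ℕ → ℕ → Prop}
    (hR : ∀ n : ℕ, 1 ≤ n → R ((K * n) ^ D) ((K * n) ^ D'))
    (hT : ∀ n : ℕ, 1 ≤ n → 0 ≤ T ((K * n) ^ D) ((K * n) ^ D') ∧
      T ((K * n) ^ D) ((K * n) ^ D') ≤ C₀ * (n : ℝ) ^ (((d * ℓ : ℕ) : ℝ) - 1)) :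
    NoCombinatorialAlgorithm 𝒞 d R T := by
  have hbase : ∀ n, 1 ≤ n → 1 ≤ K * n := fun n hn => Nat.mul_pos (by omega) hn
  have hclique : ∀ n, 1 ≤ n → ∀ G : SimpleGraph (Fin n), _ := fun n hn G =>
    translationSet_ne_empty_iff (G := G) (N := (K * n) ^ D) (M := (K * n) ^ D')
      (valid_cliqueLayout hn hd hdK hℓK hK hℓ hℓ₁) (Nat.pow_le_pow_right (hbase n hn) hD)
      (Nat.pow_le_pow_right (hbase n hn) hD')
  have hrange : ∀ n, 1 ≤ n → (0 : ℝ) < (32 * (cliqueLayout d ℓ ℓ₁ K n).range : ℕ) := fun n hn =>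
    Nat.cast_pos.2 (Nat.mul_pos (by norm_num) (Nat.pow_pos (hbase n hn)))
  have hP : ∀ n, 1 ≤ n → ∀ G : SimpleGraph (Fin n), Function.Injective
      fun (z : Fin ((K * n) ^ D)) (c : Fin d) =>
        (cliqueLayout d ℓ ℓ₁ K n).scaledPoint G ((K * n) ^ D) z c := fun n hn G y z h =>
    injective_of_int_add_div
      (f := fun z => (cliqueLayout d ℓ ℓ₁ K n).scaledPoint G ((K * n) ^ D) z 0)
      (hrange n hn) (fun _ => rfl) (congrFun h ⟨0, hd⟩)
  have hQ : ∀ n, 1 ≤ n → Function.Injective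
      fun (z : Fin ((K * n) ^ D')) (c : Fin d) =>
        (cliqueLayout d ℓ ℓ₁ K n).scaledCube n ((K * n) ^ D') z c := fun n hn y z h =>
    injective_of_int_add_div
      (f := fun z => (cliqueLayout d ℓ ℓ₁ K n).scaledCube n ((K * n) ^ D') z 0)
      (hrange n hn) (fun _ => rfl) (congrFun h ⟨0, hd⟩)
  constructor
  · rintro ⟨p, hp, C, c, h⟩
    refine false_of_fast_program (ℓ₁ := ℓ₁) hyp hd hk hT hp thresholdAnswer_fits (C := C) (c := c)
      fun n hn G => ?_
    have hN := Nat.one_le_pow D _ (hbase n hn)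
    have hM := Nat.one_le_pow D' _ (hbase n hn)
    obtain ⟨t, s, hexec, ht, hs⟩ := h _ _ hN hM (hR n hn) _ _ (hP n hn G) (hQ n hn)
    refine ⟨t, s, hexec, ht, fun inp => ?_⟩
    rw [thresholdAnswer_eval, isLeast_le_half_iff hN hM hs, hclique n hn G]
  · rintro ⟨p, hp, C, c, h⟩
    refine false_of_fast_program (ℓ₁ := ℓ₁) hyp hd hk hT hp negatedAnswer_fits (C := C) (c := c)
      fun n hn G => ?_
    obtain ⟨t, s, hexec, ht, hs⟩ := h _ _ (Nat.one_le_pow D _ (hbase n hn))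
      (Nat.one_le_pow D' _ (hbase n hn)) (hR n hn) _ _ (hP n hn G) (hQ n hn)
    refine ⟨t, s, hexec, ht, fun inp => ?_⟩
    rw [negatedAnswer_eval, Ne, hs, ← hclique n hn G]

end LowerBound

/-! ### Choice of the parameters -/

theorem NoCombinatorialAlgorithm.mono {𝒞 : Set Program} {d : ℕ} {R R' : ℕ → ℕ → Prop}
    {T T' : ℕ → ℕ → ℝ} (h : NoCombinatorialAlgorithm 𝒞 d R T)
    (hR : ∀ n m, 1 ≤ n → 1 ≤ m → R n m → R' n m)
    (hT : ∀ n m, R n m → T' n m = T n m) :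
    NoCombinatorialAlgorithm 𝒞 d R' T' := by
  constructor
  · rintro ⟨p, hp, C, c, hs⟩
    refine h.1 ⟨p, hp, C, c, fun n m hn hm hnm => ?_⟩
    rw [← hT n m hnm]
    exact hs n m hn hm (hR n m hn hm hnm)
  · rintro ⟨p, hp, C, c, hs⟩
    refine h.2 ⟨p, hp, C, c, fun n m hn hm hnm => ?_⟩
    rw [← hT n m hnm]
    exact hs n m hn hm (hR n m hn hm hnm)

theorem noCombinatorialAlgorithm_rat (𝒞 : Set Program) (hyp : CombinatorialCliqueHypothesis 𝒞)
    (d : ℕ) (hd : 1 ≤ d) (γ : ℚ) (hγ : 0 < γ) (hγ₁ : γ ≤ 1) (δ : ℝ) (hδ : 0 < δ) :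
    NoCombinatorialAlgorithm 𝒞 d (fun n m => (m : ℝ) = (n : ℝ) ^ (γ : ℝ))
      (fun n m => ((m : ℝ) * (n : ℝ)) ^ ((d : ℝ) / 2 - δ)) := by
  obtain ⟨a, ha⟩ : ∃ a : ℕ, γ.num = a := Int.eq_ofNat_of_zero_le (Rat.num_nonneg.2 hγ.le)
  set b := γ.den with hb
  have hb0 : 1 ≤ b := γ.den_pos
  have hγab : γ = a / b := by
    rw [← Rat.num_div_den γ, ha]
    simp [hb]
  have ha0 : 1 ≤ a := by
    have := Rat.num_pos.2 hγ
    omega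
  have hab : a ≤ b := by
    have hb' : (0 : ℚ) < b := by exact_mod_cast hb0
    rw [hγab, div_le_one hb'] at hγ₁
    exact_mod_cast hγ₁
  -- For `γ = a / b` the time exponent in `K * n` is `(a + b) * (2 * e + 7) * (d / 2 - δ)`. It is at
  -- most `d * ℓ - 1` once `(2 * e + 7) * δ` exceeds the overhead `7 * d / 2` by `1`; adding `3`
  -- makes `ℓ` at least `6`.
  obtain ⟨e₀, he₀⟩ := exists_nat_ge ((7 * d / 2 + 1) / δ)
  set e := e₀ + 3 with he
  have heδ : 7 * (d : ℝ) / 2 + 1 ≤ (2 * e + 7) * δ := by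
    rw [div_le_iff₀ hδ] at he₀
    have : (e₀ : ℝ) * δ ≤ (2 * e + 7) * δ := by
      refine mul_le_mul_of_nonneg_right ?_ hδ.le
      rw [he]
      push_cast
      linarith [(Nat.cast_nonneg e₀ : (0 : ℝ) ≤ e₀)]
    linarith
  set ℓ := (a + b) * e with hℓ
  set K := 5 + d + ℓ with hK
  have hae : a * e ≤ b * e := Nat.mul_le_mul_right e hab
  have hℓe : ℓ = a * e + b * e := add_mul a b e
  have h6 : 6 ≤ ℓ := by
    have : 2 * 3 ≤ (a + b) * e := Nat.mul_le_mul (by omega) (by omega)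
    omega
  have hdℓ : ℓ ≤ d * ℓ := Nat.le_mul_of_pos_left ℓ hd
  -- The points need exponent `7 + 2 * b * e` and the hypercubes `5 + 2 * a * e`. Rounding up to `b`
  -- and `a` times `2 * e + 7` makes the ratio exactly `γ`; `γ ≤ 1` gives `ℓ₁ ≤ ℓ`.
  refine noCombinatorialAlgorithm_of_le (ℓ := ℓ) (ℓ₁ := 2 * (a * e)) (K := K)
    (D := b * (2 * e + 7)) (D' := a * (2 * e + 7)) (C₀ := (K : ℝ) ^ (((d * ℓ : ℕ) : ℝ) - 1))
    hyp hd (by omega) (by omega) (by omega) (by omega) (by omega) (by omega) ?_ ?_ ?_ ?_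
  · have : b * (2 * e + 7) = 2 * (b * e) + 7 * b := by ring
    omega
  · have : a * (2 * e + 7) = 2 * (a * e) + 7 * a := by ring
    omega
  · intro n hn
    have hb' : (b : ℝ) ≠ 0 := by exact_mod_cast (by omega : b ≠ 0)
    have hpos : (0 : ℝ) ≤ ((K * n : ℕ) : ℝ) := Nat.cast_nonneg _
    push_cast [hγab] at hpos ⊢
    rw [← Real.rpow_natCast, ← Real.rpow_natCast, ← Real.rpow_mul hpos]
    congr 1
    push_cast
    field_simp
  · intro n hn
    refine ⟨by positivity, ?_⟩
    have hKn : (1 : ℝ) ≤ (K * n : ℝ) := by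
      exact_mod_cast Nat.mul_pos (by omega : 0 < K) hn
    rw [← Real.mul_rpow (Nat.cast_nonneg _) (Nat.cast_nonneg _)]
    push_cast
    rw [← pow_add, ← Real.rpow_natCast, ← Real.rpow_mul (by linarith)]
    refine Real.rpow_le_rpow_of_exponent_le hKn ?_
    push_cast [hℓ]
    have hab1 : (1 : ℝ) ≤ a + b := by exact_mod_cast (by omega : 1 ≤ a + b)
    have h := mul_le_mul_of_nonneg_left heδ (by linarith : (0 : ℝ) ≤ a + b)
    linarith

theorem mainTheorem3 (𝒞 : Set Program) (hyp : CombinatorialCliqueHypothesis 𝒞)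
    (d : ℕ) (hd : 1 ≤ d) :
    -- `n` points and `n` unit hypercubes
    (∀ δ : ℝ, 0 < δ →
      NoCombinatorialAlgorithm 𝒞 d (fun n m => m = n) (fun n _ => (n : ℝ) ^ ((d : ℝ) - δ))) ∧
    -- `n` points and `m = n ^ γ` unit hypercubes
    (∀ γ : ℚ, 0 < γ → γ ≤ 1 → ∀ δ : ℝ, 0 < δ →
      NoCombinatorialAlgorithm 𝒞 d (fun n m => (m : ℝ) = (n : ℝ) ^ (γ : ℝ))
        (fun n m => ((m : ℝ) * (n : ℝ)) ^ ((d : ℝ) / 2 - δ))) ∧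
    -- real exponents, with `m` equal to `n ^ γ` up to arbitrarily small powers of `n`
    (∀ γ : ℝ, 0 ≤ γ → γ ≤ 1 → ∀ ε : ℝ, 0 < ε → ∀ δ : ℝ, 0 < δ →
      NoCombinatorialAlgorithm 𝒞 d
        (fun n m => (n : ℝ) ^ (γ - ε) ≤ (m : ℝ) ∧ (m : ℝ) ≤ (n : ℝ) ^ (γ + ε))
        (fun n m => ((m : ℝ) * (n : ℝ)) ^ ((d : ℝ) / 2 - δ))) := by
  refine ⟨fun δ hδ => ?_, noCombinatorialAlgorithm_rat 𝒞 hyp d hd, fun γ hγ hγ₁ ε hε δ hδ => ?_⟩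
  · refine (noCombinatorialAlgorithm_rat 𝒞 hyp d hd 1 one_pos le_rfl (δ / 2) (by linarith)).mono
      (fun n m _ _ h => ?_) (fun n m h => ?_)
    · rw [Rat.cast_one, Real.rpow_one] at h
      exact_mod_cast h
    · rw [Rat.cast_one, Real.rpow_one] at h
      simp only [h]
      rw [← pow_two, ← Real.rpow_natCast, ← Real.rpow_mul (Nat.cast_nonneg n)]
      congr 1
      push_cast
      ring
  -- A rational exponent within `ε` of `γ` yields a subfamily of the admitted inputs that is already
  -- hard.
  · obtain ⟨q, hq₁, hq₂⟩ := exists_rat_btwn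
      (show max 0 (γ - ε) < min 1 (γ + ε) from max_lt (lt_min one_pos (by linarith))
        (lt_min (by linarith) (by linarith)))
    have hq0 : 0 < q := by exact_mod_cast (le_max_left _ _).trans_lt hq₁
    have hq1 : q ≤ 1 := by exact_mod_cast (hq₂.trans_le (min_le_left _ _)).le
    refine (noCombinatorialAlgorithm_rat 𝒞 hyp d hd q hq0 hq1 δ hδ).mono
      (fun n m hn _ h => ?_) (fun _ _ _ => rfl)
    have hn' : (1 : ℝ) ≤ n := by exact_mod_cast hn
    rw [h]
    exact ⟨Real.rpow_le_rpow_of_exponent_le hn' ((le_max_right _ _).trans hq₁.le),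
      Real.rpow_le_rpow_of_exponent_le hn' (hq₂.le.trans (min_le_right _ _))⟩
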